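/- Let $ABC$ be a (non-degenerate) triangle in the Euclidean plane with side lengths $a=BC$, $b=CA$, $c=AB$, semiperimeter $s$, inradius $r$ and exradii $r_A,r_B,r_C$. Consider the triples $(\omega_1,\omega_2,\omega_3)$ of circles, of radii $r_1,r_2,r_3>0$, such that $\omega_1$ is tangent to the lines $CA$ and $AB$, $\omega_2$ is tangent to the lines $AB$ and $BC$, $\omega_3$ is tangent to the lines $BC$ and $CA$, any two of the three circles are tangent to each other, and the nine points of tangency are distinct. **Theorem.** For every triangle there are exactly 32 such triples. Each of them belongs to one of the following seven cases, where $\angle CAB$ etc. stands for the open angular region and an overline means that the side of the angle through that point is replaced by the opposite ray; the centers of $\omega_1,\omega_2,\omega_3$ lie, respectively, in 1. $\angle CAB,\ \angle ABC,\ \angle BCA$; 2. $\angle CAB,\ \angle\overline{A}BC,\ \angle BC\overline{A}$; 3. $\angle\overline{C}A\overline{B},\ \angle AB\overline{C},\ \angle\overline{B}CA$; 4. $\angle CA\overline{B},\ \angle ABC,\ \angle\overline{B}CA$; 5. $\angle\overline{C}AB,\ \angle\overline{A}B\overline{C},\ \angle BC\overline{A}$; 6. $\angle\overline{C}AB,\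 \angle AB\overline{C},\ \angle BCA$; 7. $\angle CA\overline{B},\ \angle\overline{A}BC,\ \angle\overline{B}C\overline{A}$. Exactly 8 triples belong to Case 1, exactly 8 to Case 2 or 3, exactly 8 to Case 4 or 5, and exactly 8 to Case 6 or 7. For factors $\rho_1,\rho_2,\rho_3$, functions $f_1,f_2,f_3$ and reals $\alpha,\beta,\gamma$, put $\sigma=(\alpha+\beta+\gamma)/2$ and let $\mathcal R(\rho_1f_1,\rho_2f_2,\rho_3f_3;\alpha,\beta,\gamma)$ denote the list of the four triples $$\bigl(\rho_1f_1(\sigma-\alpha),\ \rho_2f_2(\sigma-\beta),\ \rho_3f_3(\sigma-\gamma)\bigr),$$ $$\bigl(\rho_1f_1(\sigma),\ \rho_2f_2(\sigma-\gamma),\ \rho_3f_3(\sigma-\beta)\bigr),$$ $$\bigl(\rho_1f_1(\sigma-\gamma),\ \rho_2f_2(\sigma),\ \rho_3f_3(\sigma-\alpha)\bigr),$$ $$\bigl(\rho_1f_1(\sigma-\beta),\ \rho_2f_2(\sigma-\alpha),\ \rho_3f_3(\sigma)\bigr).$$ In each of the four groups the 8 triples of circles correspond one-to-one to the 8 entries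 of the two lists below, the radii $(r_1,r_2,r_3)$ of each triple being the corresponding entry. * Case 1: $\mathcal R(r_A\sin^2,r_B\sin^2,r_C\sin^2;\alpha,\beta,\gamma)$ and $\mathcal R(r_A\cos^2,r_B\cos^2,r_C\cos^2;\alpha,\beta,\gamma)$, where $\alpha,\beta,\gamma\in(0,\pi/2)$, $\sin^2\alpha=\frac as$, $\sin^2\beta=\frac bs$, $\sin^2\gamma=\frac cs$. * Cases 2 and 3: $\mathcal R(r\cosh^2,r_C\sinh^2,r_B\sinh^2;\alpha_A,\beta_A,\gamma_A)$ and $\mathcal R(r\sinh^2,r_C\cosh^2,r_B\cosh^2;\alpha_A,\beta_A,\gamma_A)$, where $\alpha_A,\beta_A,\gamma_A>0$, $\sinh^2\alpha_A=\frac a{s-a}$, $\sinh^2\beta_A=\frac{s-c}{s-a}$, $\sinh^2\gamma_A=\frac{s-b}{s-a}$. * Cases 4 and 5: $\mathcal R(r_C\sinh^2,r\cosh^2,r_A\sinh^2;\alpha_B,\beta_B,\gamma_B)$ and $\mathcal R(r_C\cosh^2,r\sinh^2,r_A\cosh^2;\alpha_B,\beta_B,\gamma_B)$, where $\alpha_B,\beta_B,\gamma_B>0$,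 $\sinh^2\alpha_B=\frac{s-c}{s-b}$, $\sinh^2\beta_B=\frac b{s-b}$, $\sinh^2\gamma_B=\frac{s-a}{s-b}$. * Cases 6 and 7: $\mathcal R(r_B\sinh^2,r_A\sinh^2,r\cosh^2;\alpha_C,\beta_C,\gamma_C)$ and $\mathcal R(r_B\cosh^2,r_A\cosh^2,r\sinh^2;\alpha_C,\beta_C,\gamma_C)$, where $\alpha_C,\beta_C,\gamma_C>0$, $\sinh^2\alpha_C=\frac{s-b}{s-c}$, $\sinh^2\beta_C=\frac{s-a}{s-c}$, $\sinh^2\gamma_C=\frac c{s-c}$. -/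

import Mathlib

open EuclideanGeometry

namespace Malfatti

/-- The Euclidean plane. -/
abbrev Plane : Type := EuclideanSpace ℝ (Fin 2)

/-! ### The reference triangle

The vertices `A`, `B`, `C` are `T.points 0`, `T.points 1`, `T.points 2`. -/

/-- The side length `a = BC`. -/
noncomputable def sideA (T : Affine.Triangle ℝ Plane) : ℝ := dist (T.points 1) (T.points 2)

/-- The side length `b = CA`. -/
noncomputable def sideB (T : Affine.Triangle ℝ Plane) : ℝ := dist (T.points 2) (T.points 0)

/-- The side length `c = AB`. -/
noncomputable def sideC (T : Affine.Triangle ℝ Plane) : ℝ := dist (T.points 0) (T.points 1)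

/-- The semiperimeter `s`. -/
noncomputable def semi (T : Affine.Triangle ℝ Plane) : ℝ := (sideA T + sideB T + sideC T) / 2

/-- The exradius `r_A` (`i = 0`), `r_B` (`i = 1`) or `r_C` (`i = 2`) of the excircle that
corresponds to the vertex `i`. -/
noncomputable def exrad (T : Affine.Triangle ℝ Plane) (i : Fin 3) : ℝ := T.exradius {i}

/-- The line through the vertices `i` and `j`. -/
noncomputable def sideLine (T : Affine.Triangle ℝ Plane) (i j : Fin 3) :
    AffineSubspace ℝ Plane := line[ℝ, T.points i, T.points j]

/-! ### Triples of circles -/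

/-- The circles `ω₁`, `ω₂` touch (externally or internally) at `p`. -/
def CirclesTouchAt (ω₁ ω₂ : Sphere Plane) (p : Plane) : Prop :=
  ω₁.IsExtTangentAt ω₂ p ∨ ω₁.IsIntTangentAt ω₂ p ∨ ω₂.IsIntTangentAt ω₁ p

/-- `ω 0`, `ω 1`, `ω 2` are circles (of positive radius) such that `ω 0` touches `CA` at `E₁` and
`AB` at `F₁`, `ω 1` touches `AB` at `F₂` and `BC` at `D₂`, `ω 2` touches `BC` at `D₃` and `CA`
at `E₃`, any two of the circles touch each other, and the nine points of tangency are distinct. -/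
def IsMalfattiTriple (T : Affine.Triangle ℝ Plane) (ω : Fin 3 → Sphere Plane) : Prop :=
  (∀ i, 0 < (ω i).radius) ∧
  ∃ D₂ D₃ E₁ E₃ F₁ F₂ X Y Z : Plane,
    (ω 0).IsTangentAt E₁ (sideLine T 2 0) ∧ (ω 0).IsTangentAt F₁ (sideLine T 0 1) ∧
    (ω 1).IsTangentAt F₂ (sideLine T 0 1) ∧ (ω 1).IsTangentAt D₂ (sideLine T 1 2) ∧
    (ω 2).IsTangentAt D₃ (sideLine T 1 2) ∧ (ω 2).IsTangentAt E₃ (sideLine T 2 0) ∧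
    CirclesTouchAt (ω 1) (ω 2) X ∧ CirclesTouchAt (ω 2) (ω 0) Y ∧ CirclesTouchAt (ω 0) (ω 1) Z ∧
    [D₂, D₃, E₁, E₃, F₁, F₂, X, Y, Z].Nodup

/-- All the triples of circles in question. -/
def triples (T : Affine.Triangle ℝ Plane) : Set (Fin 3 → Sphere Plane) :=
  {ω | IsMalfattiTriple T ω}

/-! ### Classification by the positions of the centers -/

/-- The interior of the angle at the vertex `j` whose sides are the ray from the vertex `j` through
the vertex `i` if `p = 1`, the opposite ray if `p = -1`, and the ray from the vertex `j` through
the vertex `k` if `q = 1`, the opposite ray if `q = -1`. -/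
def angleInterior (T : Affine.Triangle ℝ Plane) (i j k : Fin 3) (p q : ℝ) : Set Plane :=
  {x | ∃ u v : ℝ, 0 < u ∧ 0 < v ∧
    x = T.points j + u • p • (T.points i - T.points j) + v • q • (T.points k - T.points j)}

/-- The seven possible cases. -/
inductive Case : Type
  | case1 | case2 | case3 | case4 | case5 | case6 | case7

/-- The centers of `ω 0`, `ω 1`, `ω 2` are inside the angles `∠CAB`, `∠ABC`, `∠BCA`, respectively,
with some of their sides replaced by the opposite rays (entries `-1`). -/
def InCase (T : Affine.Triangle ℝ Plane) (ω : Fin 3 → Sphere Plane) : Case → Prop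
  | .case1 => (ω 0).center ∈ angleInterior T 2 0 1 1 1 ∧
      (ω 1).center ∈ angleInterior T 0 1 2 1 1 ∧
      (ω 2).center ∈ angleInterior T 1 2 0 1 1
  | .case2 => (ω 0).center ∈ angleInterior T 2 0 1 1 1 ∧
      (ω 1).center ∈ angleInterior T 0 1 2 (-1) 1 ∧
      (ω 2).center ∈ angleInterior T 1 2 0 1 (-1)
  | .case3 => (ω 0).center ∈ angleInterior T 2 0 1 (-1) (-1) ∧
      (ω 1).center ∈ angleInterior T 0 1 2 1 (-1) ∧
      (ω 2).center ∈ angleInterior T 1 2 0 (-1) 1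
  | .case4 => (ω 0).center ∈ angleInterior T 2 0 1 1 (-1) ∧
      (ω 1).center ∈ angleInterior T 0 1 2 1 1 ∧
      (ω 2).center ∈ angleInterior T 1 2 0 (-1) 1
  | .case5 => (ω 0).center ∈ angleInterior T 2 0 1 (-1) 1 ∧
      (ω 1).center ∈ angleInterior T 0 1 2 (-1) (-1) ∧
      (ω 2).center ∈ angleInterior T 1 2 0 1 (-1)
  | .case6 => (ω 0).center ∈ angleInterior T 2 0 1 (-1) 1 ∧
      (ω 1).center ∈ angleInterior T 0 1 2 1 (-1) ∧
      (ω 2).center ∈ angleInterior T 1 2 0 1 1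
  | .case7 => (ω 0).center ∈ angleInterior T 2 0 1 1 (-1) ∧
      (ω 1).center ∈ angleInterior T 0 1 2 (-1) 1 ∧
      (ω 2).center ∈ angleInterior T 1 2 0 (-1) (-1)

/-- The triples that belong to a given case. -/
def triplesIn (T : Affine.Triangle ℝ Plane) (k : Case) : Set (Fin 3 → Sphere Plane) :=
  {ω | IsMalfattiTriple T ω ∧ InCase T ω k}

/-! ### The radii -/

/-- The `θ ∈ (0, π/2)` with `sin² θ = x`, for `0 < x < 1`. -/
noncomputable def sinSqArg (x : ℝ) : ℝ := Real.arcsin (√x)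

/-- The `t ∈ (0, ∞)` with `sinh² t = x`, for `0 < x`. -/
noncomputable def sinhSqArg (x : ℝ) : ℝ := Real.arsinh (√x)

theorem eq_sinSqArg_iff {x θ : ℝ} (h₀ : 0 < x) (h₁ : x < 1) :
    θ = sinSqArg x ↔ (0 < θ ∧ θ < Real.pi / 2) ∧ Real.sin θ ^ 2 = x := by
  unfold sinSqArg
  constructor
  · rintro rfl
    have h2 : √x < 1 := by
      rw [Real.sqrt_lt' one_pos]
      simpa using h₁
    have h3 : 0 < √x := Real.sqrt_pos.2 h₀
    refine ⟨⟨Real.arcsin_pos.2 h3, Real.arcsin_lt_pi_div_two.2 h2⟩, ?_⟩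
    rw [Real.sin_arcsin (by linarith) h2.le, Real.sq_sqrt h₀.le]
  · rintro ⟨⟨h2, h3⟩, rfl⟩
    rw [Real.sqrt_sq (Real.sin_nonneg_of_nonneg_of_le_pi h2.le (by linarith)),
      Real.arcsin_sin (by linarith) h3.le]

theorem eq_sinhSqArg_iff {x t : ℝ} (h₀ : 0 < x) :
    t = sinhSqArg x ↔ 0 < t ∧ Real.sinh t ^ 2 = x := by
  unfold sinhSqArg
  constructor
  · rintro rfl
    refine ⟨Real.arsinh_pos_iff.2 (Real.sqrt_pos.2 h₀), ?_⟩
    rw [Real.sinh_arsinh, Real.sq_sqrt h₀.le]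
  · rintro ⟨h2, rfl⟩
    rw [Real.sqrt_sq (Real.sinh_nonneg_iff.2 h2.le), Real.arsinh_sinh]

noncomputable def sinSq (t : ℝ) : ℝ := Real.sin t ^ 2
noncomputable def cosSq (t : ℝ) : ℝ := Real.cos t ^ 2
noncomputable def sinhSq (t : ℝ) : ℝ := Real.sinh t ^ 2
noncomputable def coshSq (t : ℝ) : ℝ := Real.cosh t ^ 2

/-- With `σ = (α + β + γ) / 2`, the four rows are triples `(r₁, r₂, r₃)` built from the factors
`ρ₁, ρ₂, ρ₃`, the functions `f₁, f₂, f₃` and the arguments `α, β, γ`. -/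
noncomputable def fourRows (ρ₁ ρ₂ ρ₃ : ℝ) (f₁ f₂ f₃ : ℝ → ℝ) (α β γ : ℝ) :
    Fin 4 → Fin 3 → ℝ :=
  let σ := (α + β + γ) / 2
  ![![ρ₁ * f₁ (σ - α), ρ₂ * f₂ (σ - β), ρ₃ * f₃ (σ - γ)],
    ![ρ₁ * f₁ σ,       ρ₂ * f₂ (σ - γ), ρ₃ * f₃ (σ - β)],
    ![ρ₁ * f₁ (σ - γ), ρ₂ * f₂ σ,       ρ₃ * f₃ (σ - α)],
    ![ρ₁ * f₁ (σ - β), ρ₂ * f₂ (σ - α), ρ₃ * f₃ σ]]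

/-- The eight triples of radii `(r₁, r₂, r₃)` for Case 1. -/
noncomputable def radiiI (T : Affine.Triangle ℝ Plane) : Fin 4 ⊕ Fin 4 → Fin 3 → ℝ :=
  let s := semi T
  let α := sinSqArg (sideA T / s)
  let β := sinSqArg (sideB T / s)
  let γ := sinSqArg (sideC T / s)
  Sum.elim
    (fourRows (exrad T 0) (exrad T 1) (exrad T 2) sinSq sinSq sinSq α β γ)
    (fourRows (exrad T 0) (exrad T 1) (exrad T 2) cosSq cosSq cosSq α β γ)

/-- The eight triples of radii for Cases 2 and 3. -/
noncomputable def radiiA (T : Affine.Triangle ℝ Plane) : Fin 4 ⊕ Fin 4 → Fin 3 → ℝ :=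
  let s := semi T
  let α := sinhSqArg (sideA T / (s - sideA T))
  let β := sinhSqArg ((s - sideC T) / (s - sideA T))
  let γ := sinhSqArg ((s - sideB T) / (s - sideA T))
  Sum.elim
    (fourRows T.inradius (exrad T 2) (exrad T 1) coshSq sinhSq sinhSq α β γ)
    (fourRows T.inradius (exrad T 2) (exrad T 1) sinhSq coshSq coshSq α β γ)

/-- The eight triples of radii for Cases 4 and 5. -/
noncomputable def radiiB (T : Affine.Triangle ℝ Plane) : Fin 4 ⊕ Fin 4 → Fin 3 → ℝ :=
  let s := semi T
  let α := sinhSqArg ((s - sideC T) / (s - sideB T))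
  let β := sinhSqArg (sideB T / (s - sideB T))
  let γ := sinhSqArg ((s - sideA T) / (s - sideB T))
  Sum.elim
    (fourRows (exrad T 2) T.inradius (exrad T 0) sinhSq coshSq sinhSq α β γ)
    (fourRows (exrad T 2) T.inradius (exrad T 0) coshSq sinhSq coshSq α β γ)

/-- The eight triples of radii for Cases 6 and 7. -/
noncomputable def radiiC (T : Affine.Triangle ℝ Plane) : Fin 4 ⊕ Fin 4 → Fin 3 → ℝ :=
  let s := semi T
  let α := sinhSqArg ((s - sideB T) / (s - sideC T))
  let β := sinhSqArg ((s - sideA T) / (s - sideC T))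
  let γ := sinhSqArg (sideC T / (s - sideC T))
  Sum.elim
    (fourRows (exrad T 1) (exrad T 0) T.inradius sinhSq sinhSq coshSq α β γ)
    (fourRows (exrad T 1) (exrad T 0) T.inradius coshSq coshSq sinhSq α β γ)

/-- The set `S` of triples of circles is in bijection with the rows of the table `R` in such a way
that the radii of each triple are the entries of the corresponding row. -/
def RadiiGivenBy (S : Set (Fin 3 → Sphere Plane)) (R : Fin 4 ⊕ Fin 4 → Fin 3 → ℝ) : Prop :=
  ∃ e : Fin 4 ⊕ Fin 4 ≃ S, ∀ n i, ((e n : Fin 3 → Sphere Plane) i).radius = R n i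

end Malfatti

/-!
Fix the orientation of the triangle and measure the distances from its side lines with signs,
positive on the side of the triangle. A circle touches a side line when the signed distance of its
center from it is plus or minus its radius. Two circles that touch the same line at distinct
points touch each other if and only if they lie on the same side of this line and the squared
distance of their points of tangency is four times the product of the radii. Thus a triple of
circles as in the theorem is given by one sign for each side line and by three radii that satisfy
three quadratic equations (`isMalfattiTriple_iff`, `Config.exists_eq_tripleOf`,
`Sizes.config_tripleOf_iff`). Conversely, for circles of this kind the nine points of tangency are
automatically distinct (`TangencyData.nodup`).

Changing all three signs and the signs of the radii does not affect the equations. It is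
therefore enough to solve them for the sign patterns `(1, 1, 1)`, `(-1, 1, 1)`, `(1, -1, 1)`,
`(1, 1, -1)`, where a solution with positive entries belongs to the pattern itself and one with
negative entries to the opposite pattern. The radii are measured by the exradii for the first
pattern, and by the inradius and two of the exradii for each of the others. After an affine change
of each unknown, the equation for a pair of circles says that a Gram determinant
`1 - p² - q² - r² + 2pqr` vanishes, where `p` is a constant and `q`, `r` are the two unknowns
(`pair_iff_gram_sub`, `pair_iff_gram_mixed`, `pair_iff_gram_add`). If `p = cos 2γ` and `q = cos u`,
this is the addition formula `r = cos (u ± 2γ)`, and if `p = cosh 2γ` and `q = cosh u`, it is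
`r = cosh (u ± 2γ)`. So the system asks for three arguments that differ, up to signs, by `2α`,
`2β`, `2γ`, and its solutions are the cosines or hyperbolic cosines of the four rows of arguments
`± α ± β ± γ`, and the negatives of these rows (`exists_signedRows_cos_eq`,
`exists_signedRows_cosh_eq`). Transformed back to radii, these are eight solutions for each pattern
(`solves_one`, `solves_A`, `solves_B`, `solves_C`).

For the pattern `(1, 1, 1)` all eight solutions are positive. Hence the opposite pattern
`(-1, -1, -1)` does not occur, and the other seven patterns are the seven cases.
-/

namespace Malfatti

/-! ### The trigonometric solution of a system of Gram equations -/

/-- The Gram determinant of three unit vectors with pairwise inner products `p`, `q`, `r`. -/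
def gram (p q r : ℝ) : ℝ := 1 - p ^ 2 - q ^ 2 - r ^ 2 + 2 * p * q * r

/-- The arguments that occur in `fourRows`. -/
noncomputable def rowArgs (α β γ : ℝ) : Fin 4 → Fin 3 → ℝ :=
  let σ := (α + β + γ) / 2
  ![![σ - α, σ - β, σ - γ], ![σ, σ - γ, σ - β], ![σ - γ, σ, σ - α], ![σ - β, σ - α, σ]]

theorem fourRows_apply (ρ₁ ρ₂ ρ₃ : ℝ) (f₁ f₂ f₃ : ℝ → ℝ) (α β γ : ℝ) (n : Fin 4) :
    fourRows ρ₁ ρ₂ ρ₃ f₁ f₂ f₃ α β γ n =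
      ![ρ₁ * f₁ (rowArgs α β γ n 0), ρ₂ * f₂ (rowArgs α β γ n 1),
        ρ₃ * f₃ (rowArgs α β γ n 2)] := by
  fin_cases n <;> rfl

/-- The rows with entries `f (2 θ)`, followed by those with entries `-f (2 θ)`, where `θ` runs
through `rowArgs`. -/
noncomputable def signedRows (f : ℝ → ℝ) (α β γ : ℝ) : Fin 4 ⊕ Fin 4 → Fin 3 → ℝ :=
  Sum.elim (fun n i ↦ f (2 * rowArgs α β γ n i)) (fun n i ↦ -f (2 * rowArgs α β γ n i))

/-- The pairs `(U 0, U 1)`, `(U 0, U 2)`, `(U 1, U 2)` satisfy the equations with vanishing Gram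
determinant whose constants are `C`, `B`, `A`. -/
def GramSystem (A B C : ℝ) (U : Fin 3 → ℝ) : Prop :=
  gram C (U 0) (U 1) = 0 ∧ gram B (U 0) (U 2) = 0 ∧ gram A (U 1) (U 2) = 0

theorem gram_neg_neg (p q r : ℝ) : gram p (-q) (-r) = gram p q r := by
  unfold gram; ring

theorem GramSystem.neg {A B C : ℝ} {U : Fin 3 → ℝ} (h : GramSystem A B C U) :
    GramSystem A B C (fun i ↦ -U i) := by
  simpa [GramSystem, gram_neg_neg] using h

theorem gram_cos_add (u v : ℝ) : gram (Real.cos (u + v)) (Real.cos u) (Real.cos v) = 0 := by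
  unfold gram
  have hu := Real.sin_sq_add_cos_sq u
  have hv := Real.sin_sq_add_cos_sq v
  rw [Real.cos_add]
  linear_combination -(Real.sin v ^ 2) * hu - (1 - Real.cos u ^ 2) * hv

theorem gram_cosh_add (u v : ℝ) : gram (Real.cosh (u + v)) (Real.cosh u) (Real.cosh v) = 0 := by
  unfold gram
  have hu := Real.cosh_sq_sub_sinh_sq u
  have hv := Real.cosh_sq_sub_sinh_sq v
  rw [Real.cosh_add]
  nlinarith

theorem gram_cos_of_eq {c u v : ℝ} (h : c = u + v ∨ c = u - v ∨ c = -u - v ∨ c = v - u) :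
    gram (Real.cos c) (Real.cos u) (Real.cos v) = 0 := by
  rcases h with rfl | rfl | rfl | rfl
  · exact gram_cos_add u v
  · simpa [sub_eq_add_neg] using gram_cos_add u (-v)
  · simpa [sub_eq_add_neg] using gram_cos_add (-u) (-v)
  · simpa [sub_eq_neg_add] using gram_cos_add (-u) v

theorem gram_cosh_of_eq {c u v : ℝ} (h : c = u + v ∨ c = u - v ∨ c = -u - v ∨ c = v - u) :
    gram (Real.cosh c) (Real.cosh u) (Real.cosh v) = 0 := by
  rcases h with rfl | rfl | rfl | rfl
  · exact gram_cosh_add u v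
  · simpa [sub_eq_add_neg] using gram_cosh_add u (-v)
  · simpa [sub_eq_add_neg] using gram_cosh_add (-u) (-v)
  · simpa [sub_eq_neg_add] using gram_cosh_add (-u) v

/-- In each row of arguments, any two entries have sum or difference `α`, `β` or `γ`, up to sign. -/
theorem rowArgs_relations (α β γ : ℝ) (n : Fin 4) :
    let u := 2 * rowArgs α β γ n 0
    let v := 2 * rowArgs α β γ n 1
    let w := 2 * rowArgs α β γ n 2
    (2 * γ = u + v ∨ 2 * γ = u - v ∨ 2 * γ = -u - v ∨ 2 * γ = v - u) ∧
    (2 * β = u + w ∨ 2 * β = u - w ∨ 2 * β = -u - w ∨ 2 * β = w - u) ∧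
    (2 * α = v + w ∨ 2 * α = v - w ∨ 2 * α = -v - w ∨ 2 * α = w - v) := by
  fin_cases n <;> simp only [rowArgs] <;> simp <;> ring_nf <;> simp

theorem gramSystem_signedRows_cos (α β γ : ℝ) (n : Fin 4 ⊕ Fin 4) :
    GramSystem (Real.cos (2 * α)) (Real.cos (2 * β)) (Real.cos (2 * γ))
      (signedRows Real.cos α β γ n) := by
  rcases n with n | n
  · obtain ⟨h1, h2, h3⟩ := rowArgs_relations α β γ n
    exact ⟨gram_cos_of_eq h1, gram_cos_of_eq h2, gram_cos_of_eq h3⟩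
  · obtain ⟨h1, h2, h3⟩ := rowArgs_relations α β γ n
    exact GramSystem.neg ⟨gram_cos_of_eq h1, gram_cos_of_eq h2, gram_cos_of_eq h3⟩

theorem gramSystem_signedRows_cosh (α β γ : ℝ) (n : Fin 4 ⊕ Fin 4) :
    GramSystem (Real.cosh (2 * α)) (Real.cosh (2 * β)) (Real.cosh (2 * γ))
      (signedRows Real.cosh α β γ n) := by
  rcases n with n | n
  · obtain ⟨h1, h2, h3⟩ := rowArgs_relations α β γ n
    exact ⟨gram_cosh_of_eq h1, gram_cosh_of_eq h2, gram_cosh_of_eq h3⟩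
  · obtain ⟨h1, h2, h3⟩ := rowArgs_relations α β γ n
    exact GramSystem.neg ⟨gram_cosh_of_eq h1, gram_cosh_of_eq h2, gram_cosh_of_eq h3⟩

/-- As a quadratic equation for `V`, the equation has the two solutions given by the addition
formula. -/
theorem eq_cos_add_or_sub {c u V : ℝ} (h : gram (Real.cos c) (Real.cos u) V = 0) :
    V = Real.cos (u + c) ∨ V = Real.cos (u - c) := by
  have hu := Real.sin_sq_add_cos_sq u
  have hc := Real.sin_sq_add_cos_sq c
  have h0 : (V - Real.cos (u + c)) * (V - Real.cos (u - c)) = 0 := by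
    unfold gram at h
    rw [Real.cos_add, Real.cos_sub]
    have hu' : Real.sin u ^ 2 = 1 - Real.cos u ^ 2 := by linarith
    have hc' : Real.sin c ^ 2 = 1 - Real.cos c ^ 2 := by linarith
    have : (Real.sin u * Real.sin c) ^ 2 = (1 - Real.cos u ^ 2) * (1 - Real.cos c ^ 2) := by
      rw [mul_pow, hu', hc']
    linear_combination -h - this
  rcases mul_eq_zero.1 h0 with h | h
  · left; linarith
  · right; linarith

theorem eq_cosh_add_or_sub {c u V : ℝ} (h : gram (Real.cosh c) (Real.cosh u) V = 0) :
    V = Real.cosh (u + c) ∨ V = Real.cosh (u - c) := by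
  have hu := Real.cosh_sq_sub_sinh_sq u
  have hc := Real.cosh_sq_sub_sinh_sq c
  have h0 : (V - Real.cosh (u + c)) * (V - Real.cosh (u - c)) = 0 := by
    unfold gram at h
    rw [Real.cosh_add, Real.cosh_sub]
    have hu' : Real.sinh u ^ 2 = Real.cosh u ^ 2 - 1 := by linarith
    have hc' : Real.sinh c ^ 2 = Real.cosh c ^ 2 - 1 := by linarith
    have : (Real.sinh u * Real.sinh c) ^ 2 = (Real.cosh u ^ 2 - 1) * (Real.cosh c ^ 2 - 1) := by
      rw [mul_pow, hu', hc']
    linear_combination -h - this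
  rcases mul_eq_zero.1 h0 with h | h
  · left; linarith
  · right; linarith

/-- For fixed `p` and `q`, the discriminant of the equation for `r` is `(1 - p ^ 2) * (1 - q ^ 2)`
up to a positive factor. -/
theorem sq_le_one_of_gram_eq_zero {p q r : ℝ} (hp : p ^ 2 < 1) (h : gram p q r = 0) :
    q ^ 2 ≤ 1 := by
  have h1 : (r - p * q) ^ 2 = (1 - p ^ 2) * (1 - q ^ 2) := by
    unfold gram at h; linear_combination -h
  by_contra! h2
  nlinarith [sq_nonneg (r - p * q), mul_pos (sub_pos.2 hp) (sub_pos.2 h2)]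

theorem one_le_sq_of_gram_eq_zero {p q r : ℝ} (hp : 1 < p ^ 2) (h : gram p q r = 0) :
    1 ≤ q ^ 2 := by
  have h1 : (r - p * q) ^ 2 = (1 - p ^ 2) * (1 - q ^ 2) := by
    unfold gram at h; linear_combination -h
  by_contra! h2
  nlinarith [sq_nonneg (r - p * q), mul_pos (sub_pos.2 hp) (sub_pos.2 h2)]

theorem gram_ne_zero_of_eq_or_eq_neg {f : ℝ → ℝ} (hf : ∀ x, f (-x) = f x) {α β γ a b g : ℝ}
    (hgram : gram (f (2 * α)) (f (2 * β)) (f (2 * γ)) ≠ 0)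
    (ha : a = α ∨ a = -α) (hb : b = β ∨ b = -β) (hg : g = γ ∨ g = -γ) :
    gram (f (2 * a)) (f (2 * b)) (f (2 * g)) ≠ 0 := by
  rcases ha with rfl | rfl <;> rcases hb with rfl | rfl <;> rcases hg with rfl | rfl <;>
    simpa only [mul_neg, hf] using hgram

/-- All the choices of signs in `a = ± α`, `b = ± β`, `g = ± γ` give, up to the signs of the
arguments, the same four rows. -/
theorem exists_rowArgs_eq {f : ℝ → ℝ} (hf : ∀ x, f (-x) = f x) {α β γ a b g : ℝ}
    (ha : a = α ∨ a = -α) (hb : b = β ∨ b = -β) (hg : g = γ ∨ g = -γ) :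
    ∃ n, f (a + b + g) = f (2 * rowArgs α β γ n 0) ∧ f (a + b - g) = f (2 * rowArgs α β γ n 1) ∧
      f (a - b + g) = f (2 * rowArgs α β γ n 2) := by
  have hf' : ∀ x y, (x = y ∨ x = -y) → f x = f y := by
    rintro x y (rfl | rfl)
    · rfl
    · exact hf y
  have key : ∀ n, (a + b + g = 2 * rowArgs α β γ n 0 ∨ a + b + g = -(2 * rowArgs α β γ n 0)) →
      (a + b - g = 2 * rowArgs α β γ n 1 ∨ a + b - g = -(2 * rowArgs α β γ n 1)) →
      (a - b + g = 2 * rowArgs α β γ n 2 ∨ a - b + g = -(2 * rowArgs α β γ n 2)) →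
      ∃ n, f (a + b + g) = f (2 * rowArgs α β γ n 0) ∧
        f (a + b - g) = f (2 * rowArgs α β γ n 1) ∧
        f (a - b + g) = f (2 * rowArgs α β γ n 2) :=
    fun n h1 h2 h3 ↦ ⟨n, hf' _ _ h1, hf' _ _ h2, hf' _ _ h3⟩
  rcases ha with rfl | rfl <;> rcases hb with rfl | rfl <;> rcases hg with rfl | rfl
  · refine key 1 ?_ ?_ ?_ <;> simp only [rowArgs, Matrix.cons_val] <;>
      exact Or.inl (by ring1)
  · refine key 2 ?_ ?_ ?_ <;> simp only [rowArgs, Matrix.cons_val] <;>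
      first | (left; ring1) | (right; ring1)
  · refine key 3 ?_ ?_ ?_ <;> simp only [rowArgs, Matrix.cons_val] <;>
      first | (left; ring1) | (right; ring1)
  · refine key 0 ?_ ?_ ?_ <;> simp only [rowArgs, Matrix.cons_val] <;>
      first | (left; ring1) | (right; ring1)
  · refine key 0 ?_ ?_ ?_ <;> simp only [rowArgs, Matrix.cons_val] <;>
      first | (left; ring1) | (right; ring1)
  · refine key 3 ?_ ?_ ?_ <;> simp only [rowArgs, Matrix.cons_val] <;>
      first | (left; ring1) | (right; ring1)
  · refine key 2 ?_ ?_ ?_ <;> simp only [rowArgs, Matrix.cons_val] <;>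
      first | (left; ring1) | (right; ring1)
  · refine key 1 ?_ ?_ ?_ <;> simp only [rowArgs, Matrix.cons_val] <;>
      exact Or.inr (by ring1)

/-- Every solution of the system with trigonometric constants is one of the eight rows. The number
`U 0 = cos u` is given, `U 1` and `U 2` are `cos (u ± 2γ)` and `cos (u ± 2β)`, and the third
equation determines `u` up to a multiple of `π`, whose parity distinguishes the two kinds of rows.
-/
theorem exists_signedRows_cos_eq {α β γ : ℝ} (hγ : Real.cos (2 * γ) ^ 2 < 1)
    (hgram : gram (Real.cos (2 * α)) (Real.cos (2 * β)) (Real.cos (2 * γ)) ≠ 0)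
    {U : Fin 3 → ℝ}
    (h : GramSystem (Real.cos (2 * α)) (Real.cos (2 * β)) (Real.cos (2 * γ)) U) :
    ∃ n, signedRows Real.cos α β γ n = U := by
  obtain ⟨hC, hB, hA⟩ := h
  obtain ⟨h1, h2⟩ := abs_le.1 ((sq_le_one_iff_abs_le_one _).1 (sq_le_one_of_gram_eq_zero hγ hC))
  obtain ⟨u, hu⟩ : ∃ u, Real.cos u = U 0 := ⟨_, Real.cos_arccos h1 h2⟩
  rw [← hu] at hC hB
  obtain ⟨g, hg, hV⟩ : ∃ g, (g = γ ∨ g = -γ) ∧ U 1 = Real.cos (u + 2 * g) := by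
    rcases eq_cos_add_or_sub hC with h | h
    · exact ⟨γ, Or.inl rfl, h⟩
    · exact ⟨-γ, Or.inr rfl, by rw [h]; ring_nf⟩
  obtain ⟨b, hb, hW⟩ : ∃ b, (b = β ∨ b = -β) ∧ U 2 = Real.cos (u + 2 * b) := by
    rcases eq_cos_add_or_sub hB with h | h
    · exact ⟨β, Or.inl rfl, h⟩
    · exact ⟨-β, Or.inr rfl, by rw [h]; ring_nf⟩
  rw [hV] at hA
  obtain ⟨a, ha, hW'⟩ : ∃ a, (a = α ∨ a = -α) ∧ U 2 = Real.cos (u + 2 * g + 2 * a) := by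
    rcases eq_cos_add_or_sub hA with h | h
    · exact ⟨α, Or.inl rfl, h⟩
    · exact ⟨-α, Or.inr rfl, by rw [h]; ring_nf⟩
  have hne := gram_ne_zero_of_eq_or_eq_neg Real.cos_neg hgram ha hb hg
  obtain ⟨k, hk⟩ := Real.cos_eq_cos_iff.1 (hW.symm.trans hW')
  rcases hk with hk | hk
  · -- `u` cancels: the three angles would be dependent, which `hgram` excludes
    refine absurd ?_ hne
    have h3 : Real.cos (2 * b) = Real.cos (2 * g + 2 * a) :=
      Real.cos_eq_cos_iff.2 ⟨k, Or.inl (by linarith)⟩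
    have h4 := gram_cos_add (2 * g) (2 * a)
    rw [← h3] at h4
    rw [← h4]
    unfold gram
    ring
  · -- now `u = kπ - (a + b + g)`
    obtain ⟨n, hn0, hn1, hn2⟩ := exists_rowArgs_eq Real.cos_neg ha hb hg
    have hshift : ∀ x, Real.cos (k * Real.pi - x) = (-1) ^ k * Real.cos x :=
      fun x ↦ Real.cos_int_mul_pi_sub x k
    have e0 : U 0 = (-1) ^ k * Real.cos (2 * rowArgs α β γ n 0) := by
      rw [← hn0, ← hshift, ← hu]
      congr 1; linarith
    have e1 : U 1 = (-1) ^ k * Real.cos (2 * rowArgs α β γ n 1) := by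
      rw [← hn1, ← hshift, hV]
      congr 1; linarith
    have e2 : U 2 = (-1) ^ k * Real.cos (2 * rowArgs α β γ n 2) := by
      rw [← hn2, ← hshift, hW]
      congr 1; linarith
    rcases show ((-1 : ℝ) ^ k = 1 ∨ (-1 : ℝ) ^ k = -1) from
        (Int.even_or_odd k).imp Even.neg_one_zpow Odd.neg_one_zpow with h5 | h5
    · refine ⟨.inl n, funext fun i ↦ ?_⟩
      rw [h5, one_mul] at e0 e1 e2
      fin_cases i
      · exact e0.symm
      · exact e1.symm
      · exact e2.symm
    · refine ⟨.inr n, funext fun i ↦ ?_⟩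
      rw [h5, neg_one_mul] at e0 e1 e2
      fin_cases i
      · exact e0.symm
      · exact e1.symm
      · exact e2.symm

/-- The solutions of the system with hyperbolic constants whose entries are hyperbolic cosines. -/
theorem exists_rowArgs_cosh_eq {α β γ : ℝ}
    (hgram : gram (Real.cosh (2 * α)) (Real.cosh (2 * β)) (Real.cosh (2 * γ)) ≠ 0)
    {U : Fin 3 → ℝ} (hU : 1 ≤ U 0)
    (h : GramSystem (Real.cosh (2 * α)) (Real.cosh (2 * β)) (Real.cosh (2 * γ)) U) :
    ∃ n, ∀ i, Real.cosh (2 * rowArgs α β γ n i) = U i := by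
  obtain ⟨hC, hB, hA⟩ := h
  obtain ⟨u, hu⟩ : ∃ u, Real.cosh u = U 0 := ⟨_, Real.cosh_arcosh hU⟩
  rw [← hu] at hC hB
  obtain ⟨g, hg, hV⟩ : ∃ g, (g = γ ∨ g = -γ) ∧ U 1 = Real.cosh (u + 2 * g) := by
    rcases eq_cosh_add_or_sub hC with h | h
    · exact ⟨γ, Or.inl rfl, h⟩
    · exact ⟨-γ, Or.inr rfl, by rw [h]; ring_nf⟩
  obtain ⟨b, hb, hW⟩ : ∃ b, (b = β ∨ b = -β) ∧ U 2 = Real.cosh (u + 2 * b) := by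
    rcases eq_cosh_add_or_sub hB with h | h
    · exact ⟨β, Or.inl rfl, h⟩
    · exact ⟨-β, Or.inr rfl, by rw [h]; ring_nf⟩
  rw [hV] at hA
  obtain ⟨a, ha, hW'⟩ : ∃ a, (a = α ∨ a = -α) ∧ U 2 = Real.cosh (u + 2 * g + 2 * a) := by
    rcases eq_cosh_add_or_sub hA with h | h
    · exact ⟨α, Or.inl rfl, h⟩
    · exact ⟨-α, Or.inr rfl, by rw [h]; ring_nf⟩
  have hne := gram_ne_zero_of_eq_or_eq_neg Real.cosh_neg hgram ha hb hg
  have habs : |u + 2 * b| = |u + 2 * g + 2 * a| := by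
    have h6 := hW.symm.trans hW'
    exact le_antisymm (Real.cosh_le_cosh.1 h6.le) (Real.cosh_le_cosh.1 h6.ge)
  rcases abs_eq_abs.1 habs with hk | hk
  · -- `u` cancels, and the constants would be dependent
    refine absurd ?_ hne
    have h4 := gram_cosh_add (2 * g) (2 * a)
    rw [← show 2 * b = 2 * g + 2 * a by linarith] at h4
    rw [← h4]
    unfold gram
    ring
  · -- now `u = -(a + b + g)`
    obtain ⟨n, hn0, hn1, hn2⟩ := exists_rowArgs_eq Real.cosh_neg ha hb hg
    refine ⟨n, fun i ↦ ?_⟩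
    fin_cases i
    · exact hn0.symm.trans ((Real.cosh_neg _).symm.trans (by
        change _ = U 0
        rw [← hu]; congr 1; linarith))
    · exact hn1.symm.trans ((Real.cosh_neg _).symm.trans (by
        change _ = U 1
        rw [hV]; congr 1; linarith))
    · exact hn2.symm.trans ((Real.cosh_neg _).symm.trans (by
        change _ = U 2
        rw [hW]; congr 1; linarith))

/-- Every solution of the system with hyperbolic constants is one of the eight rows: the first
entry is at least `1` in absolute value, and by symmetry it may be taken to be positive. -/
theorem exists_signedRows_cosh_eq {α β γ : ℝ} (hγ : 1 < Real.cosh (2 * γ) ^ 2)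
    (hgram : gram (Real.cosh (2 * α)) (Real.cosh (2 * β)) (Real.cosh (2 * γ)) ≠ 0)
    {U : Fin 3 → ℝ}
    (h : GramSystem (Real.cosh (2 * α)) (Real.cosh (2 * β)) (Real.cosh (2 * γ)) U) :
    ∃ n, signedRows Real.cosh α β γ n = U := by
  rcases le_abs.1 ((one_le_sq_iff_one_le_abs _).1 (one_le_sq_of_gram_eq_zero hγ h.1)) with h1 | h1
  · obtain ⟨n, hn⟩ := exists_rowArgs_cosh_eq hgram h1 h
    exact ⟨.inl n, funext hn⟩
  · obtain ⟨n, hn⟩ := exists_rowArgs_cosh_eq hgram h1 h.neg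
    exact ⟨.inr n, funext fun i ↦ neg_eq_iff_eq_neg.2 (hn i)⟩

/-- The four rows are distinct: with `P = f α * f β * f γ`, each entry is `P` plus the three numbers
`± Qa`, `± Qb`, `± Qc`, and the rows differ in the pattern of these signs. -/
theorem rowArgs_comp_injective {f : ℝ → ℝ} {α β γ P Qa Qb Qc : ℝ}
    (hs : f (α + β + γ) = P - Qa - Qb - Qc) (ha : f (-α + β + γ) = P - Qa + Qb + Qc)
    (hb : f (α - β + γ) = P + Qa - Qb + Qc) (hc : f (α + β - γ) = P + Qa + Qb - Qc)
    (hQa : Qa ≠ 0) (hQb : Qb ≠ 0) :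
    Function.Injective fun n i ↦ f (2 * rowArgs α β γ n i) := by
  have hs' : f (2 * ((α + β + γ) / 2)) = P - Qa - Qb - Qc := by rw [← hs]; ring_nf
  have ha' : f (2 * ((α + β + γ) / 2 - α)) = P - Qa + Qb + Qc := by rw [← ha]; ring_nf
  have hb' : f (2 * ((α + β + γ) / 2 - β)) = P + Qa - Qb + Qc := by rw [← hb]; ring_nf
  have hc' : f (2 * ((α + β + γ) / 2 - γ)) = P + Qa + Qb - Qc := by rw [← hc]; ring_nf
  intro n m h
  have h0 := congrFun h 0
  have h1 := congrFun h 1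
  have h2 := congrFun h 2
  fin_cases n <;> fin_cases m <;> first
    | rfl
    | (exfalso
       simp [rowArgs, hs', ha', hb', hc'] at h0 h1 h2
       first
         | exact hQa (by linarith)
         | exact hQb (by linarith))

/-- A row and the negative of a row differ because `P`, `Qa`, `Qb`, `Qc` are positive. -/
theorem signedRows_cos_injective {α β γ : ℝ} (hα : 0 < α ∧ α < Real.pi / 2)
    (hβ : 0 < β ∧ β < Real.pi / 2) (hγ : 0 < γ ∧ γ < Real.pi / 2) :
    Function.Injective (signedRows Real.cos α β γ) := by
  have := Real.pi_pos
  have sa := Real.sin_pos_of_pos_of_lt_pi hα.1 (by linarith)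
  have sb := Real.sin_pos_of_pos_of_lt_pi hβ.1 (by linarith)
  have sc := Real.sin_pos_of_pos_of_lt_pi hγ.1 (by linarith)
  have ca := Real.cos_pos_of_mem_Ioo ⟨by linarith, hα.2⟩
  have cb := Real.cos_pos_of_mem_Ioo ⟨by linarith, hβ.2⟩
  have cc := Real.cos_pos_of_mem_Ioo ⟨by linarith, hγ.2⟩
  obtain ⟨P, hP⟩ : ∃ P, P = Real.cos α * Real.cos β * Real.cos γ := ⟨_, rfl⟩
  obtain ⟨Qa, hQa⟩ : ∃ Q, Q = Real.cos α * Real.sin β * Real.sin γ := ⟨_, rfl⟩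
  obtain ⟨Qb, hQb⟩ : ∃ Q, Q = Real.sin α * Real.cos β * Real.sin γ := ⟨_, rfl⟩
  obtain ⟨Qc, hQc⟩ : ∃ Q, Q = Real.sin α * Real.sin β * Real.cos γ := ⟨_, rfl⟩
  have pP : 0 < P := by rw [hP]; positivity
  have pa : 0 < Qa := by rw [hQa]; positivity
  have pb : 0 < Qb := by rw [hQb]; positivity
  have pc : 0 < Qc := by rw [hQc]; positivity
  have hs : Real.cos (α + β + γ) = P - Qa - Qb - Qc := by
    rw [hP, hQa, hQb, hQc]; simp only [Real.cos_add, Real.sin_add]; ring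
  have ha : Real.cos (-α + β + γ) = P - Qa + Qb + Qc := by
    rw [hP, hQa, hQb, hQc]; simp only [Real.cos_add, Real.sin_add, Real.cos_neg, Real.sin_neg]; ring
  have hb : Real.cos (α - β + γ) = P + Qa - Qb + Qc := by
    rw [hP, hQa, hQb, hQc]; simp only [Real.cos_add, Real.cos_sub, Real.sin_sub]; ring
  have hc : Real.cos (α + β - γ) = P + Qa + Qb - Qc := by
    rw [hP, hQa, hQb, hQc]; simp only [Real.cos_add, Real.cos_sub, Real.sin_add]; ring
  have hinj := rowArgs_comp_injective hs ha hb hc pa.ne' pb.ne'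
  have hs' : Real.cos (2 * ((α + β + γ) / 2)) = P - Qa - Qb - Qc := by rw [← hs]; ring_nf
  have ha' : Real.cos (2 * ((α + β + γ) / 2 - α)) = P - Qa + Qb + Qc := by rw [← ha]; ring_nf
  have hb' : Real.cos (2 * ((α + β + γ) / 2 - β)) = P + Qa - Qb + Qc := by rw [← hb]; ring_nf
  have hc' : Real.cos (2 * ((α + β + γ) / 2 - γ)) = P + Qa + Qb - Qc := by rw [← hc]; ring_nf
  refine Function.Injective.sumElim hinj (fun n m h ↦ hinj ?_) fun n m h ↦ ?_
  · exact funext fun i ↦ neg_injective (congrFun h i)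
  · have h0 := congrFun h 0
    have h1 := congrFun h 1
    have h2 := congrFun h 2
    fin_cases n <;> fin_cases m <;>
      simp [rowArgs, hs', ha', hb', hc'] at h0 h1 h2 <;> linarith

theorem signedRows_cosh_injective {α β γ : ℝ} (hα : 0 < α) (hβ : 0 < β) (hγ : 0 < γ) :
    Function.Injective (signedRows Real.cosh α β γ) := by
  have hinj := rowArgs_comp_injective (f := Real.cosh) (α := α) (β := β) (γ := γ)
    (P := Real.cosh α * Real.cosh β * Real.cosh γ)
    (Qa := -(Real.cosh α * Real.sinh β * Real.sinh γ))
    (Qb := -(Real.sinh α * Real.cosh β * Real.sinh γ))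
    (Qc := -(Real.sinh α * Real.sinh β * Real.cosh γ))
    (by simp only [Real.cosh_add, Real.sinh_add]; ring)
    (by simp only [Real.cosh_add, Real.sinh_add, Real.cosh_neg, Real.sinh_neg]; ring)
    (by simp only [Real.cosh_add, Real.cosh_sub, Real.sinh_sub]; ring)
    (by simp only [Real.cosh_add, Real.cosh_sub, Real.sinh_add]; ring)
    (by have := Real.sinh_pos_iff.2 hβ; have := Real.sinh_pos_iff.2 hγ
        have := Real.cosh_pos α; simp only [ne_eq, neg_eq_zero]; positivity)
    (by have := Real.sinh_pos_iff.2 hα; have := Real.sinh_pos_iff.2 hγ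
        have := Real.cosh_pos β; simp only [ne_eq, neg_eq_zero]; positivity)
  refine Function.Injective.sumElim hinj (fun n m h ↦ hinj ?_) fun n m h ↦ ?_
  · exact funext fun i ↦ neg_injective (congrFun h i)
  · have h0 := congrFun h 0
    have h1 := Real.cosh_pos (2 * rowArgs α β γ n 0)
    have h2 := Real.cosh_pos (2 * rowArgs α β γ m 0)
    change Real.cosh (2 * rowArgs α β γ n 0) = -Real.cosh (2 * rowArgs α β γ m 0) at h0
    linarith

/-! ### Signed coordinates along and across a line -/

/-- The cross product (determinant) of two plane vectors. -/
def cr (v w : Plane) : ℝ := v 0 * w 1 - v 1 * w 0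

/-- The scalar product of two plane vectors, in coordinates. -/
def dt (v w : Plane) : ℝ := v 0 * w 0 + v 1 * w 1

/-- The signed distance of `X` from the line `PQ`; the factor `κ = ±1` selects the positive side. -/
noncomputable def sgd (κ : ℝ) (P Q X : Plane) : ℝ := κ * cr (Q - P) (X - P) / dist P Q

/-- The coordinate along the line from `P` to `Q` of the foot of the perpendicular from `X`, with
`P` as the origin. -/
noncomputable def pos (P Q X : Plane) : ℝ := dt (Q - P) (X - P) / dist P Q

theorem plane_ext {X Y : Plane} (h0 : X 0 = Y 0) (h1 : X 1 = Y 1) : X = Y := by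
  ext i; fin_cases i
  · exact h0
  · exact h1

theorem dist_sq_eq (X Y : Plane) : dist X Y ^ 2 = (X 0 - Y 0) ^ 2 + (X 1 - Y 1) ^ 2 := by
  rw [EuclideanSpace.dist_eq, Real.sq_sqrt (by positivity)]
  simp [Fin.sum_univ_two, Real.dist_eq, sq_abs]

theorem inner_eq_dt (v w : Plane) : inner ℝ v w = dt v w := by
  simp [dt, PiLp.inner_apply, Fin.sum_univ_two]
  ring

/-- The functions `pos` and `sgd` are Cartesian coordinates. -/
theorem dist_sq_eq_pos_sgd {κ : ℝ} (hκ : κ ^ 2 = 1) {P Q : Plane} (hPQ : P ≠ Q) (X Y : Plane) :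
    dist X Y ^ 2 = (pos P Q X - pos P Q Y) ^ 2 + (sgd κ P Q X - sgd κ P Q Y) ^ 2 := by
  have hd : dist P Q ≠ 0 := dist_ne_zero.2 hPQ
  have h2 := dist_sq_eq P Q
  have h3 : (pos P Q X - pos P Q Y) ^ 2 + (sgd κ P Q X - sgd κ P Q Y) ^ 2 =
      ((X 0 - Y 0) ^ 2 + (X 1 - Y 1) ^ 2) * ((P 0 - Q 0) ^ 2 + (P 1 - Q 1) ^ 2) /
        dist P Q ^ 2 := by
    rw [pos, pos, sgd, sgd, ← sub_div, ← sub_div, div_pow, div_pow, ← add_div]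
    congr 1
    simp only [dt, cr, PiLp.sub_apply]
    linear_combination ((Q 0 - P 0) * (X 1 - Y 1) - (Q 1 - P 1) * (X 0 - Y 0)) ^ 2 * hκ
  rw [h3, ← h2, dist_sq_eq X Y]
  field_simp

theorem eq_of_pos_eq_of_sgd_eq {κ : ℝ} (hκ : κ ^ 2 = 1) {P Q : Plane} (hPQ : P ≠ Q) {X Y : Plane}
    (h1 : pos P Q X = pos P Q Y) (h2 : sgd κ P Q X = sgd κ P Q Y) : X = Y := by
  have h := dist_sq_eq_pos_sgd hκ hPQ X Y
  rw [h1, h2] at h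
  simpa using h

theorem exists_pos_eq_sgd_eq {κ : ℝ} (hκ : κ ^ 2 = 1) {P Q : Plane} (hPQ : P ≠ Q) (p d : ℝ) :
    ∃ X, pos P Q X = p ∧ sgd κ P Q X = d := by
  have hd : dist P Q ≠ 0 := dist_ne_zero.2 hPQ
  have h2 := dist_sq_eq P Q
  refine ⟨P + !₂[(p * (Q 0 - P 0) - κ * d * (Q 1 - P 1)) / dist P Q,
    (p * (Q 1 - P 1) + κ * d * (Q 0 - P 0)) / dist P Q], ?_, ?_⟩
  · rw [pos, div_eq_iff hd]
    simp only [dt, PiLp.sub_apply, add_sub_cancel_left]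
    simp
    field_simp
    linear_combination -p * h2
  · rw [sgd, div_eq_iff hd]
    simp only [cr, PiLp.sub_apply, add_sub_cancel_left]
    simp
    field_simp
    linear_combination -d * h2 + d * ((P 0 - Q 0) ^ 2 + (P 1 - Q 1) ^ 2) * hκ

theorem sgd_self_left (κ : ℝ) (P Q : Plane) : sgd κ P Q P = 0 := by simp [sgd, cr]

theorem sgd_self_right (κ : ℝ) (P Q : Plane) : sgd κ P Q Q = 0 := by
  simp only [sgd, cr]; ring_nf

theorem mem_line_iff {κ : ℝ} (hκ : κ ^ 2 = 1) {P Q : Plane} (hPQ : P ≠ Q) {X : Plane} :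
    X ∈ line[ℝ, P, Q] ↔ sgd κ P Q X = 0 := by
  have hd : dist P Q ≠ 0 := dist_ne_zero.2 hPQ
  constructor
  · intro h
    obtain ⟨t, rfl⟩ := mem_affineSpan_pair_iff_exists_lineMap_eq.1 h
    simp only [sgd, cr, AffineMap.lineMap_apply, vsub_eq_sub, vadd_eq_add, PiLp.sub_apply,
      PiLp.add_apply, PiLp.smul_apply, smul_eq_mul]
    ring
  · intro h
    have hX : X = AffineMap.lineMap P Q (pos P Q X / dist P Q) := by
      apply eq_of_pos_eq_of_sgd_eq hκ hPQ
      · have h2 := dist_sq_eq P Q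
        simp only [AffineMap.lineMap_apply, vsub_eq_sub, vadd_eq_add]
        rw [pos, pos]
        simp only [dt, PiLp.sub_apply, PiLp.add_apply, PiLp.smul_apply, smul_eq_mul]
        field_simp
        rw [h2]
        ring
      · rw [h]
        simp only [sgd, cr, AffineMap.lineMap_apply, vsub_eq_sub, vadd_eq_add, PiLp.sub_apply,
          PiLp.add_apply, PiLp.smul_apply, smul_eq_mul]
        ring
    rw [hX]
    exact AffineMap.lineMap_mem_affineSpan_pair _ _ _

theorem pos_sub_pos {P Q : Plane} (X Y : Plane) :
    pos P Q X - pos P Q Y = dt (Q - P) (X - Y) / dist P Q := by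
  rw [pos, pos, ← sub_div]
  simp only [dt, PiLp.sub_apply]
  ring

/-- The tangency of a circle to a line in terms of the coordinates `pos` and `sgd`. -/
theorem isTangentAt_iff {κ : ℝ} (hκ : κ ^ 2 = 1) {P Q : Plane} (hPQ : P ≠ Q)
    {ω : Sphere Plane} {F : Plane} (hω : 0 < ω.radius) :
    ω.IsTangentAt F line[ℝ, P, Q] ↔
      sgd κ P Q F = 0 ∧ pos P Q F = pos P Q ω.center ∧ |sgd κ P Q ω.center| = ω.radius := by
  have hd : dist P Q ≠ 0 := dist_ne_zero.2 hPQ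
  have key : ∀ X ∈ line[ℝ, P, Q], pos P Q F = pos P Q ω.center → sgd κ P Q F = 0 →
      dist X ω.center ^ 2 = dist X F ^ 2 + (sgd κ P Q ω.center) ^ 2 := by
    intro X hX h1 h2
    rw [mem_line_iff hκ hPQ] at hX
    rw [dist_sq_eq_pos_sgd hκ hPQ, dist_sq_eq_pos_sgd hκ hPQ X F, hX, h1, h2]
    ring
  constructor
  · intro h
    have hF := (mem_line_iff hκ hPQ).1 h.mem_space
    have h1 := h.inner_left_eq_zero_of_mem (left_mem_affineSpan_pair ℝ P Q)
    have h2 := h.inner_left_eq_zero_of_mem (right_mem_affineSpan_pair ℝ P Q)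
    rw [vsub_eq_sub, vsub_eq_sub, inner_eq_dt] at h1 h2
    have hp : pos P Q F = pos P Q ω.center := by
      rw [← sub_eq_zero, pos_sub_pos, div_eq_zero_iff]
      left
      simp only [dt, PiLp.sub_apply] at h1 h2 ⊢
      linear_combination h2 - h1
    refine ⟨hF, hp, ?_⟩
    have h3 := key F h.mem_space hp hF
    rw [mem_sphere.1 h.mem_sphere, dist_self] at h3
    rw [← abs_of_pos hω, ← sq_eq_sq_iff_abs_eq_abs]
    linarith
  · rintro ⟨hF, hp, hr⟩
    have hmem : F ∈ line[ℝ, P, Q] := (mem_line_iff hκ hPQ).2 hF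
    have hsq : dist F ω.center ^ 2 = ω.radius ^ 2 := by
      rw [key F hmem hp hF, dist_self, ← hr, sq_abs]
      ring
    refine ⟨mem_sphere.2 ((sq_eq_sq₀ dist_nonneg hω.le).1 hsq), hmem, fun X hX ↦ ?_⟩
    rw [Sphere.mem_orthRadius_iff_inner_left]
    have h4 := key X hX hp hF
    have h5 := key F hmem hp hF
    rw [dist_self] at h5
    rw [vsub_eq_sub, vsub_eq_sub, inner_eq_dt]
    rw [dist_sq_eq, dist_sq_eq] at h4
    rw [dist_sq_eq] at h5
    simp only [dt, PiLp.sub_apply]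
    linear_combination (h4 - h5) / 2

/-- At the angle `CAB`, the coordinate along the side `AB` is determined by the signed distances
from the two sides. -/
theorem pos_eq_of_sgd {κ : ℝ} {A B C : Plane} (hAB : A ≠ B) (hCA : C ≠ A)
    (hD : κ * cr (B - A) (C - A) ≠ 0) (X : Plane) :
    pos A B X = (dist A B * dist C A * sgd κ C A X + dt (B - A) (C - A) * sgd κ A B X) /
      (κ * cr (B - A) (C - A)) := by
  have hd : dist A B ≠ 0 := dist_ne_zero.2 hAB
  have hd' : dist C A ≠ 0 := dist_ne_zero.2 hCA
  have h2 := dist_sq_eq A B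
  rw [eq_div_iff hD, pos, sgd, sgd]
  field_simp
  rw [h2]
  simp only [dt, cr, PiLp.sub_apply]
  ring

/-- The same for the side `CA`, where the coordinate is measured from `C`. -/
theorem pos_eq_of_sgd' {κ : ℝ} {A B C : Plane} (hAB : A ≠ B) (hCA : C ≠ A)
    (hD : κ * cr (B - A) (C - A) ≠ 0) (X : Plane) :
    pos C A X = dist C A -
      (dist A B * dist C A * sgd κ A B X + dt (B - A) (C - A) * sgd κ C A X) /
      (κ * cr (B - A) (C - A)) := by
  have hd : dist A B ≠ 0 := dist_ne_zero.2 hAB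
  have hd' : dist C A ≠ 0 := dist_ne_zero.2 hCA
  have h2 := dist_sq_eq C A
  rw [eq_sub_iff_add_eq', ← eq_sub_iff_add_eq, div_eq_iff hD, pos, sgd, sgd]
  field_simp
  rw [h2]
  simp only [dt, cr, PiLp.sub_apply]
  ring

theorem eq_of_sgd_eq {κ : ℝ} {A B C : Plane} (hAB : A ≠ B) (hCA : C ≠ A)
    (hD : κ * cr (B - A) (C - A) ≠ 0) (hκ : κ ^ 2 = 1) {X Y : Plane}
    (h1 : sgd κ C A X = sgd κ C A Y) (h2 : sgd κ A B X = sgd κ A B Y) : X = Y := by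
  refine eq_of_pos_eq_of_sgd_eq hκ hAB ?_ h2
  rw [pos_eq_of_sgd hAB hCA hD, pos_eq_of_sgd hAB hCA hD, h1, h2]

/-- The point with the signed distances `d` from the line `CA` and `e` from the line `AB`; see
`sgd_anglePoint` and `sgd_anglePoint'`. -/
noncomputable def anglePoint (κ : ℝ) (A B C : Plane) (d e : ℝ) : Plane :=
  A + (e * dist A B / (κ * cr (B - A) (C - A))) • (C - A) +
    (d * dist C A / (κ * cr (B - A) (C - A))) • (B - A)

theorem sgd_add_smul {κ : ℝ} {A B C : Plane} (u v : ℝ) :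
    sgd κ A B (A + u • (C - A) + v • (B - A)) = u * (κ * cr (B - A) (C - A)) / dist A B := by
  rw [sgd]
  simp only [cr, PiLp.sub_apply, PiLp.add_apply, PiLp.smul_apply, smul_eq_mul]
  ring

theorem sgd_add_smul' {κ : ℝ} {A B C : Plane} (u v : ℝ) :
    sgd κ C A (A + u • (C - A) + v • (B - A)) = v * (κ * cr (B - A) (C - A)) / dist C A := by
  rw [sgd]
  simp only [cr, PiLp.sub_apply, PiLp.add_apply, PiLp.smul_apply, smul_eq_mul]
  ring

theorem sgd_anglePoint {κ : ℝ} {A B C : Plane} (hAB : A ≠ B)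
    (hD : κ * cr (B - A) (C - A) ≠ 0) (d e : ℝ) : sgd κ A B (anglePoint κ A B C d e) = e := by
  have hd : dist A B ≠ 0 := dist_ne_zero.2 hAB
  rw [anglePoint, sgd_add_smul, div_mul_cancel₀ _ hD, mul_div_cancel_right₀ _ hd]

theorem sgd_anglePoint' {κ : ℝ} {A B C : Plane} (hCA : C ≠ A)
    (hD : κ * cr (B - A) (C - A) ≠ 0) (d e : ℝ) : sgd κ C A (anglePoint κ A B C d e) = d := by
  have hd : dist C A ≠ 0 := dist_ne_zero.2 hCA
  rw [anglePoint, sgd_add_smul', div_mul_cancel₀ _ hD, mul_div_cancel_right₀ _ hd]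

theorem eq_anglePoint {κ : ℝ} {A B C : Plane} (hAB : A ≠ B) (hCA : C ≠ A)
    (hD : κ * cr (B - A) (C - A) ≠ 0) (hκ : κ ^ 2 = 1) {X : Plane} {d e : ℝ}
    (h1 : sgd κ C A X = d) (h2 : sgd κ A B X = e) : X = anglePoint κ A B C d e :=
  eq_of_sgd_eq hAB hCA hD hκ (h1.trans (sgd_anglePoint' hCA hD d e).symm)
    (h2.trans (sgd_anglePoint hAB hD d e).symm)

/-- The angular regions at `A`, in terms of the signs of the signed distances. -/
theorem exists_smul_iff_sgd {κ : ℝ} {A B C : Plane} (hAB : A ≠ B) (hCA : C ≠ A)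
    (hD : 0 < κ * cr (B - A) (C - A)) (hκ : κ ^ 2 = 1) {p q : ℝ} (hp : p ^ 2 = 1)
    (hq : q ^ 2 = 1) (X : Plane) :
    (∃ u v : ℝ, 0 < u ∧ 0 < v ∧ X = A + u • p • (C - A) + v • q • (B - A)) ↔
      0 < p * sgd κ A B X ∧ 0 < q * sgd κ C A X := by
  have hd : 0 < dist A B := dist_pos.2 hAB
  have hd' : 0 < dist C A := dist_pos.2 hCA
  constructor
  · rintro ⟨u, v, hu, hv, rfl⟩
    rw [smul_smul, smul_smul, sgd_add_smul, sgd_add_smul']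
    have e1 : p * (u * p * (κ * cr (B - A) (C - A)) / dist A B) =
        u * (κ * cr (B - A) (C - A)) / dist A B := by
      linear_combination (u * (κ * cr (B - A) (C - A)) / dist A B) * hp
    have e2 : q * (v * q * (κ * cr (B - A) (C - A)) / dist C A) =
        v * (κ * cr (B - A) (C - A)) / dist C A := by
      linear_combination (v * (κ * cr (B - A) (C - A)) / dist C A) * hq
    rw [e1, e2]
    constructor <;> positivity
  · rintro ⟨h1, h2⟩
    refine ⟨p * sgd κ A B X * dist A B / (κ * cr (B - A) (C - A)),
      q * sgd κ C A X * dist C A / (κ * cr (B - A) (C - A)), by positivity, by positivity, ?_⟩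
    have h3 := eq_anglePoint hAB hCA hD.ne' hκ (X := X) rfl rfl
    rw [anglePoint] at h3
    rw [smul_smul, smul_smul]
    have e1 : p * sgd κ A B X * dist A B / (κ * cr (B - A) (C - A)) * p =
        sgd κ A B X * dist A B / (κ * cr (B - A) (C - A)) := by
      linear_combination (sgd κ A B X * dist A B / (κ * cr (B - A) (C - A))) * hp
    have e2 : q * sgd κ C A X * dist C A / (κ * cr (B - A) (C - A)) * q =
        sgd κ C A X * dist C A / (κ * cr (B - A) (C - A)) := by
      linear_combination (sgd κ C A X * dist C A / (κ * cr (B - A) (C - A))) * hq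
    rw [e1, e2]
    exact h3

/-! ### Touching circles that are tangent to the same line -/

/-- External tangency at `X`, spelled out by distances; for positive radii, `X` is then the only
common point. -/
def ExtTouch (ω₁ ω₂ : Sphere Plane) (X : Plane) : Prop :=
  dist ω₁.center ω₂.center = ω₁.radius + ω₂.radius ∧ dist X ω₁.center = ω₁.radius ∧
    dist X ω₂.center = ω₂.radius

theorem ExtTouch.symm {ω₁ ω₂ : Sphere Plane} {X : Plane} (h : ExtTouch ω₁ ω₂ X) :
    ExtTouch ω₂ ω₁ X := ⟨by rw [dist_comm, h.1, add_comm], h.2.2, h.2.1⟩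

/-- Circles that touch a line at distinct points can touch each other only externally, and then
they lie on the same side of the line. -/
theorem CirclesTouchAt.extTouch_of_pos_ne {κ : ℝ} (hκ : κ ^ 2 = 1) {P Q : Plane} (hPQ : P ≠ Q)
    {ω₁ ω₂ : Sphere Plane} {X : Plane} (h : CirclesTouchAt ω₁ ω₂ X)
    (hω₁ : 0 < ω₁.radius) (hω₂ : 0 < ω₂.radius)
    (h1 : |sgd κ P Q ω₁.center| = ω₁.radius) (h2 : |sgd κ P Q ω₂.center| = ω₂.radius)
    (hne : pos P Q ω₁.center ≠ pos P Q ω₂.center) :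
    ExtTouch ω₁ ω₂ X ∧ 0 < sgd κ P Q ω₁.center * sgd κ P Q ω₂.center ∧
      (pos P Q ω₁.center - pos P Q ω₂.center) ^ 2 = 4 * (ω₁.radius * ω₂.radius) := by
  have hd := dist_sq_eq_pos_sgd hκ hPQ ω₁.center ω₂.center
  have hpos : 0 < (pos P Q ω₁.center - pos P Q ω₂.center) ^ 2 := by
    have := sub_ne_zero.2 hne; positivity
  -- the circles do not touch internally: their centers are too far apart
  have hint : dist ω₁.center ω₂.center ^ 2 ≠ (ω₁.radius - ω₂.radius) ^ 2 := by
    rw [hd]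
    intro h
    rcases abs_choice (sgd κ P Q ω₁.center) with e1 | e1 <;>
    rcases abs_choice (sgd κ P Q ω₂.center) with e2 | e2 <;>
    rw [← h1, ← h2, e1, e2] at h <;> rw [e1] at h1 <;> rw [e2] at h2 <;>
    nlinarith [mul_pos hω₁ hω₂]
  rcases h with h | h | h
  · have hdist := h.isExtTangent.dist_center
    refine ⟨⟨hdist, mem_sphere.1 h.mem_left, mem_sphere.1 h.mem_right⟩, ?_⟩
    rw [hdist] at hd
    rcases abs_choice (sgd κ P Q ω₁.center) with e1 | e1 <;>
    rcases abs_choice (sgd κ P Q ω₂.center) with e2 | e2 <;>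
    rw [e1] at h1 <;> rw [e2] at h2
    · rw [h1, h2] at hd ⊢
      exact ⟨by positivity, by linarith⟩
    · rw [← h1, ← h2] at hd
      exact absurd hd (by nlinarith)
    · rw [← h1, ← h2] at hd
      exact absurd hd (by nlinarith)
    · rw [← h1, ← h2] at hd ⊢
      rw [← h1] at hω₁; rw [← h2] at hω₂
      exact ⟨by nlinarith [mul_pos hω₁ hω₂], by linarith⟩
  · refine absurd ?_ hint
    rw [h.isIntTangent.dist_center]
    ring
  · refine absurd ?_ hint
    rw [dist_comm, h.isIntTangent.dist_center]

/-- The converse of `CirclesTouchAt.extTouch_of_pos_ne`. -/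
theorem exists_circlesTouchAt {κ : ℝ} (hκ : κ ^ 2 = 1) {P Q : Plane} (hPQ : P ≠ Q)
    {ω₁ ω₂ : Sphere Plane} (hω₁ : 0 < ω₁.radius) (hω₂ : 0 < ω₂.radius)
    (h1 : |sgd κ P Q ω₁.center| = ω₁.radius) (h2 : |sgd κ P Q ω₂.center| = ω₂.radius)
    (hs : 0 < sgd κ P Q ω₁.center * sgd κ P Q ω₂.center)
    (hp : (pos P Q ω₁.center - pos P Q ω₂.center) ^ 2 = 4 * (ω₁.radius * ω₂.radius)) :
    ∃ X, CirclesTouchAt ω₁ ω₂ X ∧ ExtTouch ω₁ ω₂ X := by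
  have hdist : dist ω₁.center ω₂.center = ω₁.radius + ω₂.radius := by
    rw [← sq_eq_sq₀ dist_nonneg (by positivity), dist_sq_eq_pos_sgd hκ hPQ, hp]
    have h3 : sgd κ P Q ω₁.center * sgd κ P Q ω₂.center = ω₁.radius * ω₂.radius := by
      rw [← h1, ← h2, ← abs_mul, abs_of_pos hs]
    have h4 := sq_abs (sgd κ P Q ω₁.center)
    have h5 := sq_abs (sgd κ P Q ω₂.center)
    rw [h1] at h4
    rw [h2] at h5
    linear_combination -h4 - h5 - 2 * h3
  obtain ⟨X, hX⟩ := Sphere.isExtTangent_iff_dist_center.2 ⟨hdist, hω₁.le, hω₂.le⟩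
  exact ⟨X, Or.inl hX, hdist, mem_sphere.1 hX.mem_left, mem_sphere.1 hX.mem_right⟩

/-! ### The nine points of tangency -/

/-- `ABC` is a non-degenerate triangle, and `κ = ±1` is its orientation. -/
structure Oriented (κ : ℝ) (A B C : Plane) : Prop where
  sq_eq_one : κ ^ 2 = 1
  det_pos : 0 < κ * cr (B - A) (C - A)

theorem cr_rotate (A B C : Plane) : cr (C - B) (A - B) = cr (B - A) (C - A) := by
  simp only [cr, PiLp.sub_apply]; ring

theorem Oriented.rotate {κ : ℝ} {A B C : Plane} (h : Oriented κ A B C) : Oriented κ B C A :=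
  ⟨h.sq_eq_one, by rw [cr_rotate]; exact h.det_pos⟩

theorem Oriented.ne {κ : ℝ} {A B C : Plane} (h : Oriented κ A B C) : A ≠ B := by
  rintro rfl
  have := h.det_pos
  simp [cr] at this

/-- The circle touches both side lines through the vertex `A`. -/
structure Corner (κ : ℝ) (A B C : Plane) (ω : Sphere Plane) : Prop where
  radius_pos : 0 < ω.radius
  abs_prev : |sgd κ C A ω.center| = ω.radius
  abs_next : |sgd κ A B ω.center| = ω.radius

/-- For circles that touch the line `PQ`: they lie on the same side of this line, and the distance
of their points of tangency is that for circles which touch each other. -/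
structure Pair (κ : ℝ) (P Q : Plane) (ω₁ ω₂ : Sphere Plane) : Prop where
  same_side : 0 < sgd κ P Q ω₁.center * sgd κ P Q ω₂.center
  pos_sq : (pos P Q ω₁.center - pos P Q ω₂.center) ^ 2 = 4 * (ω₁.radius * ω₂.radius)

/-- The conditions on the centers and radii of three circles under which they touch the side lines
and each other. -/
structure Config (κ : ℝ) (A B C : Plane) (ω₁ ω₂ ω₃ : Sphere Plane) : Prop where
  corner₁ : Corner κ A B C ω₁
  corner₂ : Corner κ B C A ω₂
  corner₃ : Corner κ C A B ω₃
  pair₁₂ : Pair κ A B ω₁ ω₂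
  pair₂₃ : Pair κ B C ω₂ ω₃
  pair₃₁ : Pair κ C A ω₃ ω₁

/-- Three circles together with their nine points of tangency, in a form that is invariant under
cyclic permutations; see `TangencyData.rotate`. -/
structure TangencyData (κ : ℝ) (A B C : Plane) (ω₁ ω₂ ω₃ : Sphere Plane)
    (D₂ D₃ E₁ E₃ F₁ F₂ X Y Z : Plane) : Prop where
  oriented : Oriented κ A B C
  config : Config κ A B C ω₁ ω₂ ω₃
  tan_D₂ : ω₂.IsTangentAt D₂ line[ℝ, B, C]
  tan_D₃ : ω₃.IsTangentAt D₃ line[ℝ, B, C]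
  tan_E₁ : ω₁.IsTangentAt E₁ line[ℝ, C, A]
  tan_E₃ : ω₃.IsTangentAt E₃ line[ℝ, C, A]
  tan_F₁ : ω₁.IsTangentAt F₁ line[ℝ, A, B]
  tan_F₂ : ω₂.IsTangentAt F₂ line[ℝ, A, B]
  touch_X : ExtTouch ω₂ ω₃ X
  touch_Y : ExtTouch ω₃ ω₁ Y
  touch_Z : ExtTouch ω₁ ω₂ Z

section

variable {κ : ℝ} {A B C : Plane} {ω₁ ω₂ ω₃ : Sphere Plane}
  {D₂ D₃ E₁ E₃ F₁ F₂ X Y Z : Plane}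

theorem TangencyData.rotate (h : TangencyData κ A B C ω₁ ω₂ ω₃ D₂ D₃ E₁ E₃ F₁ F₂ X Y Z) :
    TangencyData κ B C A ω₂ ω₃ ω₁ E₃ E₁ F₂ F₁ D₂ D₃ Y Z X where
  oriented := h.oriented.rotate
  config := ⟨h.config.corner₂, h.config.corner₃, h.config.corner₁, h.config.pair₂₃,
    h.config.pair₃₁, h.config.pair₁₂⟩
  tan_D₂ := h.tan_E₃
  tan_D₃ := h.tan_E₁
  tan_E₁ := h.tan_F₂
  tan_E₃ := h.tan_F₁
  tan_F₁ := h.tan_D₂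
  tan_F₂ := h.tan_D₃
  touch_X := h.touch_Y
  touch_Y := h.touch_Z
  touch_Z := h.touch_X

/-- The point of tangency divides the segment between the centers in the ratio of the radii. -/
theorem ExtTouch.radius_mul_add {ω₁ ω₂ : Sphere Plane} {X : Plane} (h : ExtTouch ω₁ ω₂ X)
    (i : Fin 2) : ω₂.radius * (ω₁.center i - X i) + ω₁.radius * (ω₂.center i - X i) = 0 := by
  obtain ⟨h1, h2, h3⟩ := h
  have e1 := dist_sq_eq ω₁.center ω₂.center
  have e2 := dist_sq_eq X ω₁.center
  have e3 := dist_sq_eq X ω₂.center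
  rw [h1] at e1
  rw [h2] at e2
  rw [h3] at e3
  have key : (ω₂.radius * (ω₁.center 0 - X 0) + ω₁.radius * (ω₂.center 0 - X 0)) ^ 2 +
      (ω₂.radius * (ω₁.center 1 - X 1) + ω₁.radius * (ω₂.center 1 - X 1)) ^ 2 = 0 := by
    linear_combination (ω₁.radius * ω₂.radius) * e1 -
      (ω₂.radius ^ 2 + ω₁.radius * ω₂.radius) * e2 - (ω₁.radius ^ 2 + ω₁.radius * ω₂.radius) * e3
  have h0 := sq_nonneg (ω₂.radius * (ω₁.center 0 - X 0) + ω₁.radius * (ω₂.center 0 - X 0))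
  have h1 := sq_nonneg (ω₂.radius * (ω₁.center 1 - X 1) + ω₁.radius * (ω₂.center 1 - X 1))
  obtain rfl | rfl : i = 0 ∨ i = 1 := by omega
  · exact pow_eq_zero_iff two_ne_zero |>.1 (by linarith)
  · exact pow_eq_zero_iff two_ne_zero |>.1 (by linarith)

/-- No non-zero vector is perpendicular to both sides of an angle. -/
theorem Oriented.eq_of_dt_eq_zero (h : Oriented κ A B C) {O : Plane} (h1 : dt (B - A) (O - A) = 0)
    (h2 : dt (C - A) (O - A) = 0) : O = A := by
  have hD := h.det_pos.ne'
  have hc : cr (B - A) (C - A) ≠ 0 := right_ne_zero_of_mul hD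
  simp only [dt, cr, PiLp.sub_apply] at h1 h2 hc
  refine plane_ext ?_ ?_
  · refine sub_eq_zero.1 (mul_left_cancel₀ hc ?_)
    linear_combination (C 1 - A 1) * h1 - (B 1 - A 1) * h2
  · refine sub_eq_zero.1 (mul_left_cancel₀ hc ?_)
    linear_combination -(C 0 - A 0) * h1 + (B 0 - A 0) * h2

theorem dt_eq_zero_of_isTangentAt {ω : Sphere Plane} {P Q : Plane} {as : AffineSubspace ℝ Plane}
    (h : ω.IsTangentAt P as) (hQ : Q ∈ as) : dt (Q - P) (ω.center - P) = 0 := by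
  have h1 := h.inner_left_eq_zero_of_mem hQ
  rw [vsub_eq_sub, vsub_eq_sub, inner_eq_dt] at h1
  simp only [dt, PiLp.sub_apply] at h1 ⊢
  linear_combination -h1

theorem Oriented.eq_vertex (h : Oriented κ A B C) {p : Plane} (h1 : p ∈ line[ℝ, C, A])
    (h2 : p ∈ line[ℝ, A, B]) : p = A := by
  have hCA := h.rotate.rotate.ne
  refine eq_of_sgd_eq h.ne hCA h.det_pos.ne' h.sq_eq_one ?_ ?_
  · rw [(mem_line_iff h.sq_eq_one hCA).1 h1, sgd_self_right]
  · rw [(mem_line_iff h.sq_eq_one h.ne).1 h2, sgd_self_left]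

theorem Pair.ne (h : Pair κ A B ω₁ ω₂) (hκ : κ ^ 2 = 1) (hAB : A ≠ B) (h1 : 0 < ω₁.radius)
    (h2 : 0 < ω₂.radius) (hF₁ : ω₁.IsTangentAt F₁ line[ℝ, A, B])
    (hF₂ : ω₂.IsTangentAt F₂ line[ℝ, A, B]) : F₁ ≠ F₂ := by
  rintro rfl
  have e1 := ((isTangentAt_iff hκ hAB h1).1 hF₁).2.1
  have e2 := ((isTangentAt_iff hκ hAB h2).1 hF₂).2.1
  have e3 := h.pos_sq
  rw [← e1, ← e2] at e3
  have := mul_pos h1 h2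
  nlinarith

/-- If two circles touch a line at distinct points of the same side and a third circle touches
both of them, it does not touch the first one on the line: it would lie on the other side. -/
theorem Pair.not_extTouch (h : Pair κ A B ω₁ ω₂) (hκ : κ ^ 2 = 1) (hAB : A ≠ B)
    (h1 : 0 < ω₁.radius) (h2 : 0 < ω₂.radius)
    (hF₁ : ω₁.IsTangentAt F₁ line[ℝ, A, B]) (hF₂ : ω₂.IsTangentAt F₂ line[ℝ, A, B])
    (hX : ExtTouch ω₂ ω₃ X) : ¬ ExtTouch ω₃ ω₁ F₁ := by
  intro hF
  obtain ⟨e1, e2, e3⟩ := (isTangentAt_iff hκ hAB h1).1 hF₁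
  obtain ⟨-, -, f3⟩ := (isTangentAt_iff hκ hAB h2).1 hF₂
  have d31 := dist_sq_eq_pos_sgd hκ hAB ω₃.center ω₁.center
  have dF := dist_sq_eq_pos_sgd hκ hAB F₁ ω₃.center
  have d23 := dist_sq_eq_pos_sgd hκ hAB ω₂.center ω₃.center
  rw [hF.1] at d31
  rw [hF.2.1, e1, e2] at dF
  rw [hX.1] at d23
  have s1 := sq_abs (sgd κ A B ω₁.center)
  have s2 := sq_abs (sgd κ A B ω₂.center)
  rw [e3] at s1
  rw [f3] at s2
  have hp := h.pos_sq
  have hs := h.same_side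
  have hs' : sgd κ A B ω₁.center * sgd κ A B ω₂.center = ω₁.radius * ω₂.radius := by
    rw [← e3, ← f3, ← abs_mul, abs_of_pos hs]
  generalize pos A B ω₁.center = p1 at *
  generalize pos A B ω₂.center = p2 at *
  generalize pos A B ω₃.center = p3 at *
  generalize sgd κ A B ω₁.center = t1 at *
  generalize sgd κ A B ω₂.center = t2 at *
  generalize sgd κ A B ω₃.center = t3 at *
  generalize ω₁.radius = r1 at *
  generalize ω₂.radius = r2 at *
  generalize ω₃.radius = r3 at *
  -- `t3 = ± r3` has the sign opposite to that of `t1` and `t2`, and `p3 = p1`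
  have a1 : t1 * t3 = -(r1 * r3) := by linear_combination (d31 - dF - s1) / 2
  have a2 : r1 * t3 = -(r3 * t1) := by
    refine mul_left_cancel₀ h1.ne' ?_
    linear_combination t1 * a1 + t3 * s1
  have a3 : r1 ^ 2 * t3 ^ 2 = r1 ^ 2 * r3 ^ 2 := by
    linear_combination (r1 * t3 - r3 * t1) * a2 - r3 ^ 2 * s1
  have a4 : t3 ^ 2 = r3 ^ 2 := mul_left_cancel₀ (by positivity) a3
  have a5 : p1 = p3 := by
    have : (p1 - p3) ^ 2 = 0 := by linear_combination -dF - a4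
    exact sub_eq_zero.1 (pow_eq_zero_iff two_ne_zero |>.1 this)
  have a6 : r1 * (t2 * t3) = -(r1 * (r2 * r3)) := by
    linear_combination t2 * a2 - r3 * hs'
  have a7 : t2 * t3 = -(r2 * r3) := mul_left_cancel₀ h1.ne' (by linear_combination a6)
  -- then the second and third circles touch the line at the same point, too
  have a8 : (p2 - p3) ^ 2 = 0 := by linear_combination -d23 + s2 - a4 + 2 * a7
  rw [a5] at hp
  have := mul_pos h1 h2
  nlinarith

/-- Those inequalities between points of tangency from which all the others arise by cyclic
permutation. -/
theorem TangencyData.ne (h : TangencyData κ A B C ω₁ ω₂ ω₃ D₂ D₃ E₁ E₃ F₁ F₂ X Y Z) :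
    F₁ ≠ F₂ ∧ E₁ ≠ F₁ ∧ E₃ ≠ F₁ ∧ E₁ ≠ F₂ ∧ E₃ ≠ F₂ ∧
      Z ≠ F₁ ∧ Z ≠ F₂ ∧ Z ≠ E₁ ∧ Z ≠ E₃ ∧ Z ≠ D₂ ∧ Z ≠ D₃ ∧ Z ≠ X := by
  have hκ := h.oriented.sq_eq_one
  have hAB := h.oriented.ne
  have hBC := h.oriented.rotate.ne
  have hCA := h.oriented.rotate.rotate.ne
  have r1 := h.config.corner₁.radius_pos
  have r2 := h.config.corner₂.radius_pos
  have r3 := h.config.corner₃.radius_pos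
  have hF := h.config.pair₁₂.ne hκ hAB r1 r2 h.tan_F₁ h.tan_F₂
  have hD := h.config.pair₂₃.ne hκ hBC r2 r3 h.tan_D₂ h.tan_D₃
  have hE := h.config.pair₃₁.ne hκ hCA r3 r1 h.tan_E₃ h.tan_E₁
  have z1 : Z ∈ ω₁ := mem_sphere.2 h.touch_Z.2.1
  have z2 : Z ∈ ω₂ := mem_sphere.2 h.touch_Z.2.2
  have symm_pair : Pair κ C A ω₁ ω₃ :=
    ⟨by rw [mul_comm]; exact h.config.pair₃₁.same_side, by
      rw [mul_comm ω₁.radius, ← h.config.pair₃₁.pos_sq]; ring⟩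
  refine ⟨hF, ?_, ?_, ?_, ?_, ?_, ?_, ?_, ?_, ?_, ?_, ?_⟩
  · -- the point would be the vertex `A`, and both sides would be perpendicular to the same radius
    rintro rfl
    have := h.oriented.eq_vertex h.tan_E₁.mem_space h.tan_F₁.mem_space
    subst this
    have hO := h.oriented.eq_of_dt_eq_zero
      (dt_eq_zero_of_isTangentAt h.tan_F₁ (right_mem_affineSpan_pair ℝ _ _))
      (dt_eq_zero_of_isTangentAt h.tan_E₁ (left_mem_affineSpan_pair ℝ _ _))
    have h1 := mem_sphere.1 h.tan_F₁.mem_sphere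
    rw [hO, dist_self] at h1
    exact r1.ne h1
  · rintro rfl
    exact hE (h.tan_E₁.eq_of_mem_of_mem h.tan_F₁.mem_sphere h.tan_E₃.mem_space)
  · rintro rfl
    exact hF (h.tan_F₁.eq_of_mem_of_mem h.tan_E₁.mem_sphere h.tan_F₂.mem_space).symm
  · -- the point would be the vertex `A` and lie between the centers of two circles whose radii at
    -- this point are perpendicular to distinct lines
    rintro rfl
    have := h.oriented.eq_vertex h.tan_E₃.mem_space h.tan_F₂.mem_space
    subst this
    have hA : ExtTouch ω₂ ω₃ E₃ := ⟨h.touch_X.1, mem_sphere.1 h.tan_F₂.mem_sphere,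
      mem_sphere.1 h.tan_E₃.mem_sphere⟩
    have h0 := hA.radius_mul_add 0
    have h1 := hA.radius_mul_add 1
    have d1 := dt_eq_zero_of_isTangentAt h.tan_F₂ (right_mem_affineSpan_pair ℝ E₃ B)
    have d2 := dt_eq_zero_of_isTangentAt h.tan_E₃ (left_mem_affineSpan_pair ℝ C E₃)
    have hO : ω₂.center = E₃ := by
      refine h.oriented.eq_of_dt_eq_zero d1 (mul_left_cancel₀ r3.ne' ?_)
      simp only [dt, PiLp.sub_apply] at d2 ⊢
      linear_combination (C 0 - E₃ 0) * h0 + (C 1 - E₃ 1) * h1 - ω₂.radius * d2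
    have h1 := mem_sphere.1 h.tan_F₂.mem_sphere
    rw [hO, dist_self] at h1
    exact r2.ne h1
  · rintro rfl
    exact hF (h.tan_F₂.eq_of_mem_of_mem z2 h.tan_F₁.mem_space)
  · rintro rfl
    exact hF (h.tan_F₁.eq_of_mem_of_mem z1 h.tan_F₂.mem_space).symm
  · rintro rfl
    exact symm_pair.not_extTouch hκ hCA r1 r3 h.tan_E₁ h.tan_E₃ h.touch_X.symm h.touch_Z.symm
  · rintro rfl
    exact hE (h.tan_E₁.eq_of_mem_of_mem z1 h.tan_E₃.mem_space)
  · rintro rfl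
    exact h.config.pair₂₃.not_extTouch hκ hBC r2 r3 h.tan_D₂ h.tan_D₃ h.touch_Y h.touch_Z
  · rintro rfl
    exact hD (h.tan_D₂.eq_of_mem_of_mem z2 h.tan_D₃.mem_space).symm
  · -- three circles that touch externally have no common point: the three relations for the vectors
    -- to the centers force these vectors to vanish
    rintro rfl
    have x3 := h.touch_X.2.2
    have hY : ExtTouch ω₃ ω₁ Z := ⟨h.touch_Y.1, x3, h.touch_Z.2.1⟩
    have hO : ω₁.center = Z := by
      have key : ∀ i, ω₁.center i = Z i := by
        intro i
        have e1 := h.touch_Z.radius_mul_add i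
        have e2 := h.touch_X.radius_mul_add i
        have e3 := hY.radius_mul_add i
        refine sub_eq_zero.1 (mul_left_cancel₀ (mul_pos r2 r3).ne' ?_)
        linear_combination (ω₃.radius * e1 - ω₁.radius * e2 + ω₂.radius * e3) / 2
      exact plane_ext (key 0) (key 1)
    have h1 := h.touch_Z.2.1
    rw [hO, dist_self] at h1
    exact r1.ne h1

theorem TangencyData.nodup (h : TangencyData κ A B C ω₁ ω₂ ω₃ D₂ D₃ E₁ E₃ F₁ F₂ X Y Z) :
    [D₂, D₃, E₁, E₃, F₁, F₂, X, Y, Z].Nodup := by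
  obtain ⟨a1, a2, a3, a4, a5, a6, a7, a8, a9, a10, a11, a12⟩ := h.ne
  obtain ⟨b1, b2, b3, b4, b5, b6, b7, b8, b9, b10, b11, b12⟩ := h.rotate.ne
  obtain ⟨c1, c2, c3, c4, c5, c6, c7, c8, c9, c10, c11, c12⟩ := h.rotate.rotate.ne
  simp only [List.nodup_cons, List.mem_cons, List.not_mem_nil, or_false, not_or,
    not_false_eq_true, List.nodup_nil, and_true]
  tauto

end

section

variable {κ : ℝ} {T : Affine.Triangle ℝ Plane}

/-- The conditions on the points of tangency amount to conditions on centers and radii. In one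
direction, only the distinctness of the two points of tangency on each side is needed; in the other,
it is `TangencyData.nodup` that makes all nine points distinct. -/
theorem isMalfattiTriple_iff (h : Oriented κ (T.points 0) (T.points 1) (T.points 2))
    (ω : Fin 3 → Sphere Plane) :
    IsMalfattiTriple T ω ↔
      Config κ (T.points 0) (T.points 1) (T.points 2) (ω 0) (ω 1) (ω 2) := by
  have hκ := h.sq_eq_one
  have hAB := h.ne
  have hBC := h.rotate.ne
  have hCA := h.rotate.rotate.ne
  constructor
  · rintro ⟨hr, D₂, D₃, E₁, E₃, F₁, F₂, X, Y, Z, e1, f1, f2, d2, d3, e3, hX, hY, hZ, hnd⟩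
    have r1 := hr 0
    have r2 := hr 1
    have r3 := hr 2
    have hnd' : D₂ ≠ D₃ ∧ E₁ ≠ E₃ ∧ F₁ ≠ F₂ := by
      simp only [List.nodup_cons, List.mem_cons, List.not_mem_nil, or_false, not_or,
        not_false_eq_true, List.nodup_nil, and_true] at hnd
      tauto
    have pne : ∀ {P Q F F' : Plane} {ω ω' : Sphere Plane}, P ≠ Q → 0 < ω.radius → 0 < ω'.radius →
        ω.IsTangentAt F line[ℝ, P, Q] → ω'.IsTangentAt F' line[ℝ, P, Q] → F ≠ F' →
        pos P Q ω.center ≠ pos P Q ω'.center := by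
      intro P Q F F' ω ω' hPQ hω hω' t t' hne heq
      obtain ⟨t1, t2, -⟩ := (isTangentAt_iff hκ hPQ hω).1 t
      obtain ⟨t1', t2', -⟩ := (isTangentAt_iff hκ hPQ hω').1 t'
      exact hne (eq_of_pos_eq_of_sgd_eq hκ hPQ (t2.trans (heq.trans t2'.symm))
        (t1.trans t1'.symm))
    have e1' := ((isTangentAt_iff hκ hCA r1).1 e1).2.2
    have f1' := ((isTangentAt_iff hκ hAB r1).1 f1).2.2
    have f2' := ((isTangentAt_iff hκ hAB r2).1 f2).2.2
    have d2' := ((isTangentAt_iff hκ hBC r2).1 d2).2.2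
    have d3' := ((isTangentAt_iff hκ hBC r3).1 d3).2.2
    have e3' := ((isTangentAt_iff hκ hCA r3).1 e3).2.2
    exact ⟨⟨r1, e1', f1'⟩, ⟨r2, f2', d2'⟩, ⟨r3, d3', e3'⟩,
      ⟨(hZ.extTouch_of_pos_ne hκ hAB r1 r2 f1' f2' (pne hAB r1 r2 f1 f2 hnd'.2.2)).2.1,
       (hZ.extTouch_of_pos_ne hκ hAB r1 r2 f1' f2' (pne hAB r1 r2 f1 f2 hnd'.2.2)).2.2⟩,
      ⟨(hX.extTouch_of_pos_ne hκ hBC r2 r3 d2' d3' (pne hBC r2 r3 d2 d3 hnd'.1)).2.1,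
       (hX.extTouch_of_pos_ne hκ hBC r2 r3 d2' d3' (pne hBC r2 r3 d2 d3 hnd'.1)).2.2⟩,
      ⟨(hY.extTouch_of_pos_ne hκ hCA r3 r1 e3' e1' (pne hCA r3 r1 e3 e1 hnd'.2.1.symm)).2.1,
       (hY.extTouch_of_pos_ne hκ hCA r3 r1 e3' e1' (pne hCA r3 r1 e3 e1 hnd'.2.1.symm)).2.2⟩⟩
  · intro hc
    obtain ⟨⟨r1, e1, f1⟩, ⟨r2, f2, d2⟩, ⟨r3, d3, e3⟩, ⟨z, z'⟩, ⟨x, x'⟩, ⟨y, y'⟩⟩ := hc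
    have ext : ∀ {P Q : Plane} {ω : Sphere Plane}, P ≠ Q → 0 < ω.radius →
        |sgd κ P Q ω.center| = ω.radius → ∃ F, ω.IsTangentAt F line[ℝ, P, Q] := by
      intro P Q ω hPQ hω h
      obtain ⟨F, h1, h2⟩ := exists_pos_eq_sgd_eq hκ hPQ (pos P Q ω.center) 0
      exact ⟨F, (isTangentAt_iff hκ hPQ hω).2 ⟨h2, h1, h⟩⟩
    obtain ⟨E₁, tE₁⟩ := ext hCA r1 e1
    obtain ⟨F₁, tF₁⟩ := ext hAB r1 f1
    obtain ⟨F₂, tF₂⟩ := ext hAB r2 f2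
    obtain ⟨D₂, tD₂⟩ := ext hBC r2 d2
    obtain ⟨D₃, tD₃⟩ := ext hBC r3 d3
    obtain ⟨E₃, tE₃⟩ := ext hCA r3 e3
    obtain ⟨X, tX, hX⟩ := exists_circlesTouchAt hκ hBC r2 r3 d2 d3 x x'
    obtain ⟨Y, tY, hY⟩ := exists_circlesTouchAt hκ hCA r3 r1 e3 e1 y y'
    obtain ⟨Z, tZ, hZ⟩ := exists_circlesTouchAt hκ hAB r1 r2 f1 f2 z z'
    refine ⟨fun i ↦ by fin_cases i <;> assumption, D₂, D₃, E₁, E₃, F₁, F₂, X, Y, Z,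
      tE₁, tF₁, tF₂, tD₂, tD₃, tE₃, tX, tY, tZ, TangencyData.nodup (κ := κ) (A := T.points 0)
        (B := T.points 1) (C := T.points 2) (ω₁ := ω 0) (ω₂ := ω 1) (ω₃ := ω 2) ?_⟩
    exact ⟨h, ⟨⟨r1, e1, f1⟩, ⟨r2, f2, d2⟩, ⟨r3, d3, e3⟩, ⟨z, z'⟩, ⟨x, x'⟩, ⟨y, y'⟩⟩,
      tD₂, tD₃, tE₁, tE₃, tF₁, tF₂, hX, hY, hZ⟩

end

/-! ### Triples of circles as signs and radii -/

/-- The tangent lengths `x = s - a`, `y = s - b`, `z = s - c` and the inradius `r` of the triangle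
`ABC`, together with the two area formulas: Heron's `r ^ 2 * s = x * y * z`, and `2 * r * s` for
twice the area. -/
structure Sizes (κ : ℝ) (A B C : Plane) (x y z r : ℝ) : Prop where
  oriented : Oriented κ A B C
  x_pos : 0 < x
  y_pos : 0 < y
  z_pos : 0 < z
  r_pos : 0 < r
  dist_BC : dist B C = y + z
  dist_CA : dist C A = z + x
  dist_AB : dist A B = x + y
  r_sq : r ^ 2 * (x + y + z) = x * y * z
  det_eq : κ * cr (B - A) (C - A) = 2 * r * (x + y + z)

/-- Consider an angle the cotangent of whose half is `x / r`, and a point with the signed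
distances `d` and `e` from its sides. This is the signed distance from the vertex to the foot of
the perpendicular from this point to the side from which `e` is measured. For `d = e` the point is
on the bisector of the angle and this is `d * (x / r)`, and for `d = -e` it is on the outer
bisector. -/
noncomputable def ct (r x d e : ℝ) : ℝ := (d + e) / 2 * (x / r) + (d - e) / 2 * (r / x)

/-- The equations for the (signed) radii `R` of three circles on the sides `e` of the three side
lines: the squared distance of the points of tangency on each of `AB`, `BC`, `CA` is four times
the product of the radii. -/
def System (x y z r : ℝ) (e R : Fin 3 → ℝ) : Prop :=
  (ct r x (e 1 * R 0) (e 2 * R 0) + ct r y (e 0 * R 1) (e 2 * R 1) - (x + y)) ^ 2 =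
    4 * (R 0 * R 1) ∧
  (ct r y (e 2 * R 1) (e 0 * R 1) + ct r z (e 1 * R 2) (e 0 * R 2) - (y + z)) ^ 2 =
    4 * (R 1 * R 2) ∧
  (ct r z (e 0 * R 2) (e 1 * R 2) + ct r x (e 2 * R 0) (e 1 * R 0) - (z + x)) ^ 2 =
    4 * (R 2 * R 0)

theorem system_neg {x y z r : ℝ} {e R : Fin 3 → ℝ} :
    System x y z r (-e) (-R) ↔ System x y z r e R := by
  simp [System]

/-- The circles with the (signed) radii `R` on the sides `e` of the lines `BC`, `CA`, `AB`, where a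
circle of negative radius is the one of radius `|R|` on the opposite sides. -/
noncomputable def tripleOf (κ : ℝ) (A B C : Plane) (e R : Fin 3 → ℝ) : Fin 3 → Sphere Plane :=
  ![⟨anglePoint κ A B C (e 1 * R 0) (e 2 * R 0), |R 0|⟩,
    ⟨anglePoint κ B C A (e 2 * R 1) (e 0 * R 1), |R 1|⟩,
    ⟨anglePoint κ C A B (e 0 * R 2) (e 1 * R 2), |R 2|⟩]

theorem tripleOf_neg (κ : ℝ) (A B C : Plane) (e R : Fin 3 → ℝ) :
    tripleOf κ A B C (-e) (-R) = tripleOf κ A B C e R := by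
  simp [tripleOf]

section

variable {κ : ℝ} {A B C : Plane} {x y z r : ℝ}

theorem Sizes.rotate (h : Sizes κ A B C x y z r) : Sizes κ B C A y z x r where
  oriented := h.oriented.rotate
  x_pos := h.y_pos
  y_pos := h.z_pos
  z_pos := h.x_pos
  r_pos := h.r_pos
  dist_BC := h.dist_CA
  dist_CA := h.dist_AB
  dist_AB := h.dist_BC
  r_sq := by linear_combination h.r_sq
  det_eq := by rw [cr_rotate, h.det_eq]; ring

/-- The law of cosines. -/
theorem two_mul_dt (A B C : Plane) :
    2 * dt (B - A) (C - A) = dist C A ^ 2 + dist A B ^ 2 - dist B C ^ 2 := by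
  rw [dist_sq_eq, dist_sq_eq, dist_sq_eq]
  simp only [dt, PiLp.sub_apply]
  ring

theorem dt_sq_add_cr_sq (A B C : Plane) :
    dt (B - A) (C - A) ^ 2 + cr (B - A) (C - A) ^ 2 = dist A B ^ 2 * dist C A ^ 2 := by
  rw [dist_sq_eq, dist_sq_eq]
  simp only [dt, cr, PiLp.sub_apply]
  ring

/-- The strict triangle inequality, in the form `0 < s - a`. -/
theorem Oriented.semi_sub_pos (h : Oriented κ A B C) :
    0 < (dist B C + dist C A + dist A B) / 2 - dist B C := by
  have h1 := two_mul_dt A B C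
  have h2 := dt_sq_add_cr_sq A B C
  have hc : 0 < dist A B := dist_pos.2 h.ne
  have ha : 0 < dist B C := dist_pos.2 h.rotate.ne
  have hb : 0 < dist C A := dist_pos.2 h.rotate.rotate.ne
  have hcr : cr (B - A) (C - A) ≠ 0 := right_ne_zero_of_mul h.det_pos.ne'
  have h3 : 0 < cr (B - A) (C - A) ^ 2 := by positivity
  have h4 : -(dist A B * dist C A) < dt (B - A) (C - A) := by
    have : |dt (B - A) (C - A)| < |dist A B * dist C A| := sq_lt_sq.1 (by nlinarith)
    rw [abs_of_pos (mul_pos hc hb)] at this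
    exact (abs_lt.1 this).1
  nlinarith

theorem Oriented.sizes (h : Oriented κ A B C) {s x y z : ℝ}
    (hs : s = (dist B C + dist C A + dist A B) / 2) (hx : x = s - dist B C)
    (hy : y = s - dist C A) (hz : z = s - dist A B) :
    Sizes κ A B C x y z (κ * cr (B - A) (C - A) / (2 * s)) := by
  have x_pos : 0 < x := by rw [hx, hs]; exact h.semi_sub_pos
  have y_pos : 0 < y := by
    rw [hy, hs]; convert h.rotate.semi_sub_pos using 2; ring
  have z_pos : 0 < z := by
    rw [hz, hs]; convert h.rotate.rotate.semi_sub_pos using 2; ring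
  have e : s = x + y + z := by rw [hx, hy, hz]; linarith
  have s_pos : 0 < s := by rw [e]; positivity
  refine ⟨h, x_pos, y_pos, z_pos, by have := h.det_pos; positivity, by linarith, by linarith,
    by linarith, ?_, ?_⟩
  · have h1 := two_mul_dt A B C
    have h2 := dt_sq_add_cr_sq A B C
    rw [show dist B C = y + z by linarith, show dist C A = z + x by linarith,
      show dist A B = x + y by linarith] at *
    have h3 : dt (B - A) (C - A) = x * (x + y + z) - y * z := by linarith
    rw [h3] at h2
    have h4 := h.sq_eq_one
    rw [← e, div_pow, mul_pow, h4]
    field_simp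
    rw [e]
    linear_combination h2
  · rw [← e]
    field_simp

/-- The feet of the perpendiculars on the side `AB`, measured from `A`. -/
theorem Sizes.pos_eq (h : Sizes κ A B C x y z r) (X : Plane) :
    pos A B X = ct r x (sgd κ C A X) (sgd κ A B X) := by
  have hx := h.x_pos
  have hy := h.y_pos
  have hz := h.z_pos
  have hr := h.r_pos
  have hdt : dt (B - A) (C - A) = x * (x + y + z) - y * z := by
    have := two_mul_dt A B C
    rw [h.dist_BC, h.dist_CA, h.dist_AB] at this
    linarith
  rw [pos_eq_of_sgd h.oriented.ne h.oriented.rotate.rotate.ne h.oriented.det_pos.ne', h.det_eq,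
    h.dist_CA, h.dist_AB, hdt, ct, div_eq_iff (by positivity)]
  field_simp
  linear_combination (sgd κ C A X - sgd κ A B X) * (-1) * h.r_sq

/-- The feet of the perpendiculars on the side `CA`, measured from `C`. -/
theorem Sizes.pos_eq' (h : Sizes κ A B C x y z r) (X : Plane) :
    pos C A X = (z + x) - ct r x (sgd κ A B X) (sgd κ C A X) := by
  have hx := h.x_pos
  have hy := h.y_pos
  have hz := h.z_pos
  have hr := h.r_pos
  have hdt : dt (B - A) (C - A) = x * (x + y + z) - y * z := by
    have := two_mul_dt A B C
    rw [h.dist_BC, h.dist_CA, h.dist_AB] at this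
    linarith
  rw [pos_eq_of_sgd' h.oriented.ne h.oriented.rotate.rotate.ne h.oriented.det_pos.ne', h.det_eq,
    h.dist_CA, h.dist_AB, hdt, ct]
  congr 1
  rw [div_eq_iff (by positivity)]
  field_simp
  linear_combination (sgd κ A B X - sgd κ C A X) * (-1) * h.r_sq

theorem Oriented.sgd_tripleOf (h : Oriented κ A B C) (e R : Fin 3 → ℝ) :
    sgd κ C A (tripleOf κ A B C e R 0).center = e 1 * R 0 ∧
    sgd κ A B (tripleOf κ A B C e R 0).center = e 2 * R 0 ∧
    sgd κ A B (tripleOf κ A B C e R 1).center = e 2 * R 1 ∧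
    sgd κ B C (tripleOf κ A B C e R 1).center = e 0 * R 1 ∧
    sgd κ B C (tripleOf κ A B C e R 2).center = e 0 * R 2 ∧
    sgd κ C A (tripleOf κ A B C e R 2).center = e 1 * R 2 := by
  have hAB := h.ne
  have hBC := h.rotate.ne
  have hCA := h.rotate.rotate.ne
  exact ⟨sgd_anglePoint' hCA h.det_pos.ne' _ _, sgd_anglePoint hAB h.det_pos.ne' _ _,
    sgd_anglePoint' hAB h.rotate.det_pos.ne' _ _, sgd_anglePoint hBC h.rotate.det_pos.ne' _ _,
    sgd_anglePoint' hBC h.rotate.rotate.det_pos.ne' _ _,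
    sgd_anglePoint hCA h.rotate.rotate.det_pos.ne' _ _⟩

theorem Oriented.tripleOf_injective (h : Oriented κ A B C) {e : Fin 3 → ℝ} (he : ∀ i, e i ≠ 0) :
    Function.Injective (tripleOf κ A B C e) := by
  intro R R' hR
  obtain ⟨h1, h2, h3, h4, h5, h6⟩ := h.sgd_tripleOf e R
  obtain ⟨g1, g2, g3, g4, g5, g6⟩ := h.sgd_tripleOf e R'
  rw [hR] at h1 h3 h5
  funext i
  fin_cases i
  · exact mul_left_cancel₀ (he 1) (h1.symm.trans g1)
  · exact mul_left_cancel₀ (he 2) (h3.symm.trans g3)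
  · exact mul_left_cancel₀ (he 0) (h5.symm.trans g5)

/-- For positive radii, `System` says that the three circles touch each other; that they touch the
side lines is built into `tripleOf`. -/
theorem Sizes.config_tripleOf_iff (h : Sizes κ A B C x y z r) {e R : Fin 3 → ℝ}
    (he : ∀ i, e i = 1 ∨ e i = -1) (hR : ∀ i, 0 < R i) :
    Config κ A B C (tripleOf κ A B C e R 0) (tripleOf κ A B C e R 1) (tripleOf κ A B C e R 2) ↔
      System x y z r e R := by
  obtain ⟨h1, h2, h3, h4, h5, h6⟩ := h.oriented.sgd_tripleOf e R
  have R0 : (tripleOf κ A B C e R 0).radius = R 0 := abs_of_pos (hR 0)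
  have R1 : (tripleOf κ A B C e R 1).radius = R 1 := abs_of_pos (hR 1)
  have R2 : (tripleOf κ A B C e R 2).radius = R 2 := abs_of_pos (hR 2)
  have habs : ∀ i j, |e i * R j| = R j := by
    intro i j
    rcases he i with h | h <;> simp [h, abs_of_pos (hR j)]
  have hpos : ∀ i j k, 0 < (e i * R j) * (e i * R k) := by
    intro i j k
    have := mul_pos (hR j) (hR k)
    rcases he i with h | h <;> rw [h] <;> linarith
  have p1 := h.pos_eq (tripleOf κ A B C e R 0).center
  have p2 := h.rotate.pos_eq' (tripleOf κ A B C e R 1).center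
  have p3 := h.rotate.pos_eq (tripleOf κ A B C e R 1).center
  have p4 := h.rotate.rotate.pos_eq' (tripleOf κ A B C e R 2).center
  have p5 := h.rotate.rotate.pos_eq (tripleOf κ A B C e R 2).center
  have p6 := h.pos_eq' (tripleOf κ A B C e R 0).center
  rw [h1, h2] at p1 p6
  rw [h3, h4] at p2 p3
  rw [h5, h6] at p4 p5
  constructor
  · rintro ⟨-, -, -, ⟨-, q1⟩, ⟨-, q2⟩, ⟨-, q3⟩⟩
    rw [p1, p2, R0, R1] at q1
    rw [p3, p4, R1, R2] at q2
    rw [p5, p6, R2, R0] at q3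
    refine ⟨?_, ?_, ?_⟩
    · rw [← q1]; ring
    · rw [← q2]; ring
    · rw [← q3]; ring
  · rintro ⟨q1, q2, q3⟩
    refine ⟨⟨?_, ?_, ?_⟩, ⟨?_, ?_, ?_⟩, ⟨?_, ?_, ?_⟩, ⟨?_, ?_⟩, ⟨?_, ?_⟩, ⟨?_, ?_⟩⟩
    · rw [R0]; exact hR 0
    · rw [h1, R0]; exact habs _ _
    · rw [h2, R0]; exact habs _ _
    · rw [R1]; exact hR 1
    · rw [h3, R1]; exact habs _ _
    · rw [h4, R1]; exact habs _ _
    · rw [R2]; exact hR 2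
    · rw [h5, R2]; exact habs _ _
    · rw [h6, R2]; exact habs _ _
    · rw [h2, h3]; exact hpos _ _ _
    · rw [p1, p2, R0, R1, ← q1]; ring
    · rw [h4, h5]; exact hpos _ _ _
    · rw [p3, p4, R1, R2, ← q2]; ring
    · rw [h6, h1]; exact hpos _ _ _
    · rw [p5, p6, R2, R0, ← q3]; ring

theorem exists_sign_mul {d d' ρ ρ' : ℝ} (hρ : 0 < ρ) (hρ' : 0 < ρ') (h : |d| = ρ) (h' : |d'| = ρ')
    (hd : 0 < d * d') : ∃ e : ℝ, (e = 1 ∨ e = -1) ∧ d = e * ρ ∧ d' = e * ρ' := by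
  rcases abs_choice d with h1 | h1 <;> rcases abs_choice d' with h2 | h2 <;>
    rw [h1] at h <;> rw [h2] at h'
  · exact ⟨1, Or.inl rfl, by linarith, by linarith⟩
  · exact absurd hd (by nlinarith)
  · exact absurd hd (by nlinarith)
  · exact ⟨-1, Or.inr rfl, by linarith, by linarith⟩

/-- The two circles at each side line are on the same side of it, so that one sign for each line
describes the position of all three circles. -/
theorem Config.exists_eq_tripleOf (h : Oriented κ A B C) {ω : Fin 3 → Sphere Plane}
    (hc : Config κ A B C (ω 0) (ω 1) (ω 2)) :
    ∃ e R, (∀ i, e i = 1 ∨ e i = -1) ∧ (∀ i, 0 < R i) ∧ ω = tripleOf κ A B C e R := by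
  have hκ := h.sq_eq_one
  have hAB := h.ne
  have hBC := h.rotate.ne
  have hCA := h.rotate.rotate.ne
  obtain ⟨⟨r1, e1, f1⟩, ⟨r2, f2, d2⟩, ⟨r3, d3, e3⟩, ⟨z, -⟩, ⟨x, -⟩, ⟨y, -⟩⟩ := hc
  obtain ⟨ea, ha, da1, da2⟩ := exists_sign_mul r2 r3 d2 d3 x
  obtain ⟨eb, hb, db1, db2⟩ := exists_sign_mul r3 r1 e3 e1 y
  obtain ⟨ec, hc, dc1, dc2⟩ := exists_sign_mul r1 r2 f1 f2 z
  refine ⟨![ea, eb, ec], fun i ↦ (ω i).radius, ?_, ?_, ?_⟩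
  · intro i; fin_cases i <;> assumption
  · intro i; fin_cases i <;> assumption
  · funext i
    fin_cases i
    · exact Sphere.ext (eq_anglePoint hAB hCA h.det_pos.ne' hκ db2 dc1) (abs_of_pos r1).symm
    · exact Sphere.ext (eq_anglePoint hBC hAB h.rotate.det_pos.ne' hκ dc2 da1) (abs_of_pos r2).symm
    · exact Sphere.ext (eq_anglePoint hCA hBC h.rotate.rotate.det_pos.ne' hκ da2 db1)
        (abs_of_pos r3).symm

end

/-! ### The radii for each pattern of signs -/

theorem gram_swap (p q r : ℝ) : gram p r q = gram p q r := by
  unfold gram; ring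

theorem gram_cycle (p q r : ℝ) : gram q r p = gram p q r := by
  unfold gram; ring

/-- If an entry of a solution were `± 1`, the other two would be its products with two of the
constants, and the third equation would be a dependence between the constants. -/
theorem GramSystem.sq_ne_one {A B C : ℝ} (hgram : gram A B C ≠ 0) {U : Fin 3 → ℝ}
    (h : GramSystem A B C U) (i : Fin 3) : U i ^ 2 ≠ 1 := by
  obtain ⟨h1, h2, h3⟩ := h
  have key : ∀ {p q V W T : ℝ}, gram p T V = 0 → gram q T W = 0 → T ^ 2 = 1 →
      V = T * p ∧ W = T * q := by
    intro p q V W T hp hq hT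
    unfold gram at hp hq
    constructor
    · exact sub_eq_zero.1 (pow_eq_zero_iff two_ne_zero |>.1
        (by linear_combination (p ^ 2 - 1) * hT - hp))
    · exact sub_eq_zero.1 (pow_eq_zero_iff two_ne_zero |>.1
        (by linear_combination (q ^ 2 - 1) * hT - hq))
  have key2 : ∀ {p q t T : ℝ}, gram t (T * p) (T * q) = 0 → T ^ 2 = 1 → gram t p q = 0 := by
    intro p q t T h hT
    unfold gram at *
    linear_combination h + (p ^ 2 + q ^ 2 - 2 * t * p * q) * hT
  intro hU
  obtain rfl | rfl | rfl : i = 0 ∨ i = 1 ∨ i = 2 := by omega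
  · obtain ⟨e1, e2⟩ := key h1 h2 hU
    rw [e1, e2] at h3
    exact hgram ((gram_swap _ _ _).symm.trans (key2 h3 hU))
  · obtain ⟨e1, e2⟩ := key ((gram_swap _ _ _).trans h1) h3 hU
    rw [e1, e2] at h2
    refine hgram ?_
    rw [← key2 h2 hU]
    unfold gram; ring
  · obtain ⟨e1, e2⟩ := key ((gram_swap _ _ _).trans h2) ((gram_swap _ _ _).trans h3) hU
    rw [e1, e2] at h1
    refine hgram ?_
    rw [← key2 h1 hU]
    unfold gram; ring

/-- The affine change of variables, coordinate by coordinate, from radii to the unknowns of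
`GramSystem`. It turns `R i = ρ i * sin² θ` into `cos (2 * θ)` if `v i = 1`, `u = -1`, and
`R i = ρ i * cosh² θ` or `ρ i * sinh² θ` into `cosh (2 * θ)` if `u = 1` and `v i = -1` or `1`. -/
noncomputable def toGram (u : ℝ) (v ρ R : Fin 3 → ℝ) : Fin 3 → ℝ :=
  fun i ↦ v i + u * (2 * (R i / ρ i))

theorem toGram_injective {u : ℝ} (hu : u ≠ 0) (v : Fin 3 → ℝ) {ρ : Fin 3 → ℝ}
    (hρ : ∀ i, 0 < ρ i) : Function.Injective (toGram u v ρ) := by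
  intro R R' h
  funext i
  have h1 := congrFun h i
  simp only [toGram, add_right_inj] at h1
  have h2 := mul_left_cancel₀ two_ne_zero (mul_left_cancel₀ hu h1)
  exact (div_left_inj' (hρ i).ne').1 h2

theorem toGram_fourRows {f : ℝ → ℝ} {u : ℝ} {v ρ : Fin 3 → ℝ} (hρ : ∀ i, 0 < ρ i)
    {f₁ f₂ f₃ : ℝ → ℝ} (h₁ : ∀ θ, v 0 + u * (2 * f₁ θ) = f (2 * θ))
    (h₂ : ∀ θ, v 1 + u * (2 * f₂ θ) = f (2 * θ)) (h₃ : ∀ θ, v 2 + u * (2 * f₃ θ) = f (2 * θ))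
    (α β γ : ℝ) (n : Fin 4) :
    toGram u v ρ (fourRows (ρ 0) (ρ 1) (ρ 2) f₁ f₂ f₃ α β γ n) =
      fun i ↦ f (2 * rowArgs α β γ n i) := by
  rw [fourRows_apply]
  funext i
  obtain rfl | rfl | rfl : i = 0 ∨ i = 1 ∨ i = 2 := by omega
  · rw [← h₁]
    simp only [toGram, Matrix.cons_val]
    rw [mul_div_cancel_left₀ _ (hρ 0).ne']
  · rw [← h₂]
    simp only [toGram, Matrix.cons_val]
    rw [mul_div_cancel_left₀ _ (hρ 1).ne']
  · rw [← h₃]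
    simp only [toGram, Matrix.cons_val]
    rw [mul_div_cancel_left₀ _ (hρ 2).ne']

theorem fourRows_nonneg {ρ : Fin 3 → ℝ} (hρ : ∀ i, 0 < ρ i) {f₁ f₂ f₃ : ℝ → ℝ}
    (h₁ : ∀ θ, 0 ≤ f₁ θ) (h₂ : ∀ θ, 0 ≤ f₂ θ) (h₃ : ∀ θ, 0 ≤ f₃ θ) (α β γ : ℝ) (n : Fin 4)
    (i : Fin 3) : 0 ≤ fourRows (ρ 0) (ρ 1) (ρ 2) f₁ f₂ f₃ α β γ n i := by
  rw [fourRows_apply]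
  obtain rfl | rfl | rfl : i = 0 ∨ i = 1 ∨ i = 2 := by omega
  · exact mul_nonneg (hρ 0).le (h₁ _)
  · exact mul_nonneg (hρ 1).le (h₂ _)
  · exact mul_nonneg (hρ 2).le (h₃ _)

/-- The table `rows` lists, without repetition, the solutions of the system `P`, and the entries of
each of these solutions are non-zero. -/
structure Solves (P : (Fin 3 → ℝ) → Prop) (rows : Fin 4 ⊕ Fin 4 → Fin 3 → ℝ) : Prop where
  injective : Function.Injective rows
  iff : ∀ R, P R ↔ ∃ n, rows n = R
  ne_zero : ∀ n i, rows n i ≠ 0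

/-- Solutions of `GramSystem` translate into solutions of a system for radii. As `v i ^ 2 = 1`, a
radius that vanishes would give an entry `± 1`, which `GramSystem.sq_ne_one` excludes. -/
theorem Solves.of_signedRows {f : ℝ → ℝ} {α β γ A B C : ℝ} {P : (Fin 3 → ℝ) → Prop}
    {rows : Fin 4 ⊕ Fin 4 → Fin 3 → ℝ} {u : ℝ} {v ρ : Fin 3 → ℝ}
    (hinj : Function.Injective (signedRows f α β γ))
    (hiff : ∀ U, GramSystem A B C U ↔ ∃ n, signedRows f α β γ n = U) (hgram : gram A B C ≠ 0)
    (hu : u ≠ 0) (hv : ∀ i, v i ^ 2 = 1) (hρ : ∀ i, 0 < ρ i)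
    (hrows : ∀ n, toGram u v ρ (rows n) = signedRows f α β γ n)
    (hP : ∀ R, P R ↔ GramSystem A B C (toGram u v ρ R)) : Solves P rows where
  injective n m h := hinj (by rw [← hrows, ← hrows, h])
  iff R := by
    rw [hP, hiff]
    refine exists_congr fun n ↦ ?_
    rw [← hrows]
    exact (toGram_injective hu v hρ).eq_iff
  ne_zero n i h := by
    have h1 : GramSystem A B C (toGram u v ρ (rows n)) := (hiff _).2 ⟨n, (hrows n).symm⟩
    refine h1.sq_ne_one hgram i ?_
    simp [toGram, h, hv i]

theorem cos_two_mul_eq (θ : ℝ) : Real.cos (2 * θ) = 1 - 2 * Real.sin θ ^ 2 := by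
  rw [Real.cos_two_mul]; linarith [Real.sin_sq_add_cos_sq θ]

theorem cosh_two_mul_eq (θ : ℝ) : Real.cosh (2 * θ) = 1 + 2 * Real.sinh θ ^ 2 := by
  rw [Real.cosh_two_mul]; linarith [Real.cosh_sq_sub_sinh_sq θ]

theorem gramSystem_cos_iff {a b c : ℝ} (ha : 0 < a ∧ a < 1) (hb : 0 < b ∧ b < 1)
    (hc : 0 < c ∧ c < 1) (hgram : gram (1 - 2 * a) (1 - 2 * b) (1 - 2 * c) ≠ 0) :
    Function.Injective (signedRows Real.cos (sinSqArg a) (sinSqArg b) (sinSqArg c)) ∧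
    ∀ U, GramSystem (1 - 2 * a) (1 - 2 * b) (1 - 2 * c) U ↔
      ∃ n, signedRows Real.cos (sinSqArg a) (sinSqArg b) (sinSqArg c) n = U := by
  obtain ⟨ha1, ha2⟩ := (eq_sinSqArg_iff ha.1 ha.2).1 rfl
  obtain ⟨hb1, hb2⟩ := (eq_sinSqArg_iff hb.1 hb.2).1 rfl
  obtain ⟨hc1, hc2⟩ := (eq_sinSqArg_iff hc.1 hc.2).1 rfl
  have ea := cos_two_mul_eq (sinSqArg a)
  have eb := cos_two_mul_eq (sinSqArg b)
  have ec := cos_two_mul_eq (sinSqArg c)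
  rw [ha2] at ea
  rw [hb2] at eb
  rw [hc2] at ec
  refine ⟨signedRows_cos_injective ha1 hb1 hc1, fun U ↦ ⟨fun h ↦ ?_, ?_⟩⟩
  · rw [← ea, ← eb, ← ec] at h hgram
    refine exists_signedRows_cos_eq ?_ hgram h
    rw [ec]
    nlinarith [hc.1, hc.2]
  · rintro ⟨n, rfl⟩
    rw [← ea, ← eb, ← ec]
    exact gramSystem_signedRows_cos _ _ _ n

theorem gramSystem_cosh_iff {a b c : ℝ} (ha : 0 < a) (hb : 0 < b) (hc : 0 < c)
    (hgram : gram (1 + 2 * a) (1 + 2 * b) (1 + 2 * c) ≠ 0) :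
    Function.Injective (signedRows Real.cosh (sinhSqArg a) (sinhSqArg b) (sinhSqArg c)) ∧
    ∀ U, GramSystem (1 + 2 * a) (1 + 2 * b) (1 + 2 * c) U ↔
      ∃ n, signedRows Real.cosh (sinhSqArg a) (sinhSqArg b) (sinhSqArg c) n = U := by
  obtain ⟨ha1, ha2⟩ := (eq_sinhSqArg_iff ha).1 rfl
  obtain ⟨hb1, hb2⟩ := (eq_sinhSqArg_iff hb).1 rfl
  obtain ⟨hc1, hc2⟩ := (eq_sinhSqArg_iff hc).1 rfl
  have ea := cosh_two_mul_eq (sinhSqArg a)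
  have eb := cosh_two_mul_eq (sinhSqArg b)
  have ec := cosh_two_mul_eq (sinhSqArg c)
  rw [ha2] at ea
  rw [hb2] at eb
  rw [hc2] at ec
  refine ⟨signedRows_cosh_injective ha1 hb1 hc1, fun U ↦ ⟨fun h ↦ ?_, ?_⟩⟩
  · rw [← ea, ← eb, ← ec] at h hgram
    refine exists_signedRows_cosh_eq ?_ hgram h
    rw [ec]
    nlinarith
  · rintro ⟨n, rfl⟩
    rw [← ea, ← eb, ← ec]
    exact gramSystem_signedRows_cosh _ _ _ n

section

variable {x y z r : ℝ}

theorem ct_self (r x d : ℝ) : ct r x d d = d * (x / r) := by unfold ct; ring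

theorem ct_neg' (r x d : ℝ) : ct r x (-d) d = -(d * (r / x)) := by unfold ct; ring

theorem ct_neg (r x d : ℝ) : ct r x d (-d) = d * (r / x) := by unfold ct; ring

/-- The equation for two circles whose centers are on the inner bisectors of the angles at `A` and
`B`; the radii are measured by the exradii `r_A` and `r_B`. -/
theorem pair_iff_gram_sub (hx : 0 < x) (hy : 0 < y) (hz : 0 < z) (hr : 0 < r)
    (h : r ^ 2 * (x + y + z) = x * y * z) (R R' : ℝ) :
    (R * (x / r) + R' * (y / r) - (x + y)) ^ 2 = 4 * (R * R') ↔
      gram (1 - 2 * ((x + y) / (x + y + z))) (1 - 2 * (R / (r * (x + y + z) / x)))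
        (1 - 2 * (R' / (r * (x + y + z) / y))) = 0 := by
  obtain ⟨s, hs⟩ : ∃ s, s = x + y + z := ⟨_, rfl⟩
  have s_pos : 0 < s := by rw [hs]; positivity
  rw [← hs] at h ⊢
  obtain ⟨X, rfl⟩ : ∃ X, R = r * s / x * X := ⟨R / (r * s / x), by field_simp⟩
  obtain ⟨Y, rfl⟩ : ∃ Y, R' = r * s / y * Y := ⟨R' / (r * s / y), by field_simp⟩
  have e1 : r * s / x * X * (x / r) = s * X := by field_simp
  have e2 : r * s / y * Y * (y / r) = s * Y := by field_simp
  have e3 : r * s / x * X * (r * s / y * Y) = s * z * (X * Y) := by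
    field_simp; linear_combination X * Y * h
  rw [e1, e2, e3, mul_div_cancel_left₀ _ (by positivity), mul_div_cancel_left₀ _ (by positivity),
    ← sub_eq_zero]
  have key : gram (1 - 2 * ((x + y) / s)) (1 - 2 * X) (1 - 2 * Y) =
      -4 / s ^ 2 * ((s * X + s * Y - (x + y)) ^ 2 - 4 * (s * z * (X * Y))) := by
    unfold gram
    rw [show z = s - x - y by linarith]
    field_simp
    ring
  rw [key, mul_eq_zero, or_iff_right]
  have : 0 < s ^ 2 := by positivity
  exact div_ne_zero (by norm_num) this.ne'

/-- The equation for two circles of which the first has its center on the inner bisector of the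
angle at `A` and the second on the outer bisector at `B`; the radii are measured by the inradius
and `r_C`. -/
theorem pair_iff_gram_mixed (hx : 0 < x) (hy : 0 < y) (hz : 0 < z) (hr : 0 < r)
    (h : r ^ 2 * (x + y + z) = x * y * z) (R R' : ℝ) :
    (R * (x / r) - R' * (r / y) - (x + y)) ^ 2 = 4 * (R * R') ↔
      gram (1 + 2 * (y / x)) (-1 + 2 * (R / r)) (1 + 2 * (R' / (r * (x + y + z) / z))) = 0 := by
  obtain ⟨s, hs⟩ : ∃ s, s = x + y + z := ⟨_, rfl⟩
  have s_pos : 0 < s := by rw [hs]; positivity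
  rw [← hs] at h ⊢
  obtain ⟨X, rfl⟩ : ∃ X, R = r * X := ⟨R / r, by field_simp⟩
  obtain ⟨Y, rfl⟩ : ∃ Y, R' = r * s / z * Y := ⟨R' / (r * s / z), by field_simp⟩
  have e1 : r * X * (x / r) = x * X := by field_simp
  have e2 : r * s / z * Y * (r / y) = x * Y := by
    field_simp; linear_combination Y * h
  have e3 : r * X * (r * s / z * Y) = x * y * (X * Y) := by
    field_simp; linear_combination X * Y * h
  rw [e1, e2, e3, mul_div_cancel_left₀ _ (by positivity), mul_div_cancel_left₀ _ (by positivity),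
    ← sub_eq_zero]
  have key : gram (1 + 2 * (y / x)) (-1 + 2 * X) (1 + 2 * Y) =
      -4 / x ^ 2 * ((x * X - x * Y - (x + y)) ^ 2 - 4 * (x * y * (X * Y))) := by
    unfold gram
    field_simp
    ring
  rw [key, mul_eq_zero, or_iff_right]
  have : 0 < x ^ 2 := by positivity
  exact div_ne_zero (by norm_num) this.ne'

/-- The equation for two circles whose centers are on the outer bisectors of the angles at `A` and
`B`; the radii are measured by the exradii `r_B` and `r_A`. -/
theorem pair_iff_gram_add (hx : 0 < x) (hy : 0 < y) (hz : 0 < z) (hr : 0 < r)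
    (h : r ^ 2 * (x + y + z) = x * y * z) (R R' : ℝ) :
    (R * (r / x) + R' * (r / y) - (x + y)) ^ 2 = 4 * (R * R') ↔
      gram (1 + 2 * ((x + y) / z)) (1 + 2 * (R / (r * (x + y + z) / y)))
        (1 + 2 * (R' / (r * (x + y + z) / x))) = 0 := by
  obtain ⟨s, hs⟩ : ∃ s, s = x + y + z := ⟨_, rfl⟩
  have s_pos : 0 < s := by rw [hs]; positivity
  rw [← hs] at h ⊢
  obtain ⟨X, rfl⟩ : ∃ X, R = r * s / y * X := ⟨R / (r * s / y), by field_simp⟩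
  obtain ⟨Y, rfl⟩ : ∃ Y, R' = r * s / x * Y := ⟨R' / (r * s / x), by field_simp⟩
  have e1 : r * s / y * X * (r / x) = z * X := by
    field_simp; linear_combination X * h
  have e2 : r * s / x * Y * (r / y) = z * Y := by
    field_simp; linear_combination Y * h
  have e3 : r * s / y * X * (r * s / x * Y) = s * z * (X * Y) := by
    field_simp; linear_combination X * Y * h
  rw [e1, e2, e3, mul_div_cancel_left₀ _ (by positivity), mul_div_cancel_left₀ _ (by positivity),
    ← sub_eq_zero]
  have key : gram (1 + 2 * ((x + y) / z)) (1 + 2 * X) (1 + 2 * Y) =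
      -4 / z ^ 2 * ((z * X + z * Y - (x + y)) ^ 2 - 4 * (s * z * (X * Y))) := by
    unfold gram
    rw [hs]
    field_simp
    ring
  rw [key, mul_eq_zero, or_iff_right]
  have : 0 < z ^ 2 := by positivity
  exact div_ne_zero (by norm_num) this.ne'

theorem gram_sub_ne_zero (hx : 0 < x) (hy : 0 < y) (hz : 0 < z) :
    gram (1 - 2 * ((y + z) / (x + y + z))) (1 - 2 * ((z + x) / (x + y + z)))
      (1 - 2 * ((x + y) / (x + y + z))) ≠ 0 := by
  have h : gram (1 - 2 * ((y + z) / (x + y + z))) (1 - 2 * ((z + x) / (x + y + z)))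
      (1 - 2 * ((x + y) / (x + y + z))) = 16 * (x * y * z) / (x + y + z) ^ 3 := by
    unfold gram
    field_simp
    ring
  rw [h]
  positivity

theorem gram_add_ne_zero (hx : 0 < x) (hy : 0 < y) (hz : 0 < z) :
    gram (1 + 2 * ((y + z) / x)) (1 + 2 * (z / x)) (1 + 2 * (y / x)) ≠ 0 := by
  have h : gram (1 + 2 * ((y + z) / x)) (1 + 2 * (z / x)) (1 + 2 * (y / x)) =
      16 * ((x + y + z) * y * z) / x ^ 3 := by
    unfold gram
    field_simp
    ring
  rw [h]
  positivity

/-- A table of radii with the signs of the entries in its second half changed. -/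
def signedRadii (R : Fin 4 ⊕ Fin 4 → Fin 3 → ℝ) : Fin 4 ⊕ Fin 4 → Fin 3 → ℝ :=
  Sum.elim (fun n i ↦ R (.inl n) i) (fun n i ↦ -R (.inr n) i)

/-- All circles on the inner sides of the lines they touch. The radii in both halves of the table
are positive. -/
theorem solves_one (hx : 0 < x) (hy : 0 < y) (hz : 0 < z) (hr : 0 < r)
    (h : r ^ 2 * (x + y + z) = x * y * z) {α β γ : ℝ}
    (hα : α = sinSqArg ((y + z) / (x + y + z))) (hβ : β = sinSqArg ((z + x) / (x + y + z)))
    (hγ : γ = sinSqArg ((x + y) / (x + y + z))) {ρ₁ ρ₂ ρ₃ : ℝ}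
    (h₁ : ρ₁ = r * (x + y + z) / x) (h₂ : ρ₂ = r * (x + y + z) / y)
    (h₃ : ρ₃ = r * (x + y + z) / z) :
    Solves (System x y z r ![1, 1, 1])
      (Sum.elim (fourRows ρ₁ ρ₂ ρ₃ sinSq sinSq sinSq α β γ)
        (fourRows ρ₁ ρ₂ ρ₃ cosSq cosSq cosSq α β γ)) := by
  have hgram := gram_sub_ne_zero hx hy hz
  obtain ⟨hinj, hiff⟩ := gramSystem_cos_iff (a := (y + z) / (x + y + z))
    (b := (z + x) / (x + y + z)) (c := (x + y) / (x + y + z))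
    ⟨by positivity, by rw [div_lt_one (by positivity)]; linarith⟩
    ⟨by positivity, by rw [div_lt_one (by positivity)]; linarith⟩
    ⟨by positivity, by rw [div_lt_one (by positivity)]; linarith⟩ hgram
  rw [← hα, ← hβ, ← hγ] at hinj hiff
  have hρ : ∀ i, 0 < (![ρ₁, ρ₂, ρ₃] : Fin 3 → ℝ) i := by
    intro i
    fin_cases i
    · simp only [h₁, Fin.zero_eta, Matrix.cons_val]; positivity
    · simp only [h₂, Fin.mk_one, Matrix.cons_val]; positivity
    · simp only [h₃, Fin.reduceFinMk, Matrix.cons_val]; positivity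
  refine Solves.of_signedRows hinj hiff hgram (u := -1) (v := ![1, 1, 1]) (ρ := ![ρ₁, ρ₂, ρ₃])
    (by norm_num) (by intro i; fin_cases i <;> simp) hρ ?_ ?_
  · have hs : ∀ θ, (1 : ℝ) + -1 * (2 * sinSq θ) = Real.cos (2 * θ) := by
      intro θ; rw [cos_two_mul_eq, sinSq]; ring
    have hc : ∀ θ, (1 : ℝ) + -1 * (2 * cosSq θ) = -Real.cos (2 * θ) := by
      intro θ; rw [Real.cos_two_mul, cosSq]; ring
    rintro (n | n)
    · exact toGram_fourRows (f := Real.cos) (v := ![1, 1, 1]) hρ hs hs hs α β γ n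
    · exact toGram_fourRows (f := fun θ ↦ -Real.cos θ) (v := ![1, 1, 1]) hρ hc hc hc α β γ n
  · intro R
    have e1 := pair_iff_gram_sub hx hy hz hr h (R 0) (R 1)
    have e2 := pair_iff_gram_sub hy hz hx hr (by linear_combination h) (R 1) (R 2)
    have e3 := pair_iff_gram_sub hz hx hy hr (by linear_combination h) (R 2) (R 0)
    rw [show y + z + x = x + y + z by ring] at e2
    rw [show z + x + y = x + y + z by ring, gram_swap] at e3
    simp only [System, GramSystem, toGram, Matrix.cons_val, one_mul, ct_self, h₁, h₂, h₃,
      neg_one_mul, ← sub_eq_add_neg, e1, e2, e3]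
    tauto

theorem fourRows_signedRadii (ρ₁ ρ₂ ρ₃ : ℝ) (f₁ f₂ f₃ g₁ g₂ g₃ : ℝ → ℝ) (α β γ : ℝ) :
    signedRadii (Sum.elim (fourRows ρ₁ ρ₂ ρ₃ f₁ f₂ f₃ α β γ) (fourRows ρ₁ ρ₂ ρ₃ g₁ g₂ g₃ α β γ)) =
      Sum.elim (fourRows ρ₁ ρ₂ ρ₃ f₁ f₂ f₃ α β γ)
        (fourRows ρ₁ ρ₂ ρ₃ (-g₁) (-g₂) (-g₃) α β γ) := by
  funext n i
  rcases n with n | n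
  · rfl
  · simp only [signedRadii, Sum.elim_inr, fourRows_apply]
    fin_cases i <;> simp

theorem coshSq_eq (θ : ℝ) : -1 + 1 * (2 * coshSq θ) = Real.cosh (2 * θ) := by
  rw [Real.cosh_two_mul, coshSq]; linarith [Real.cosh_sq_sub_sinh_sq θ]

theorem sinhSq_eq (θ : ℝ) : 1 + 1 * (2 * sinhSq θ) = Real.cosh (2 * θ) := by
  rw [cosh_two_mul_eq, sinhSq]; ring

theorem neg_coshSq_eq (θ : ℝ) : 1 + 1 * (2 * (-coshSq) θ) = -Real.cosh (2 * θ) := by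
  rw [← coshSq_eq, Pi.neg_apply]; ring

theorem neg_sinhSq_eq (θ : ℝ) : -1 + 1 * (2 * (-sinhSq) θ) = -Real.cosh (2 * θ) := by
  rw [← sinhSq_eq, Pi.neg_apply]; ring

/-- The circles that touch the line `BC` lie on its outer side, and otherwise they lie on the inner
sides. The radii in the second half of the table enter with negative signs: they belong to the
opposite sides of all three lines. -/
theorem solves_A (hx : 0 < x) (hy : 0 < y) (hz : 0 < z) (hr : 0 < r)
    (h : r ^ 2 * (x + y + z) = x * y * z) {α β γ : ℝ}
    (hα : α = sinhSqArg ((y + z) / x)) (hβ : β = sinhSqArg (z / x))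
    (hγ : γ = sinhSqArg (y / x)) {ρ₁ ρ₂ ρ₃ : ℝ}
    (h₁ : ρ₁ = r) (h₂ : ρ₂ = r * (x + y + z) / z) (h₃ : ρ₃ = r * (x + y + z) / y) :
    Solves (System x y z r ![-1, 1, 1])
      (signedRadii (Sum.elim (fourRows ρ₁ ρ₂ ρ₃ coshSq sinhSq sinhSq α β γ)
        (fourRows ρ₁ ρ₂ ρ₃ sinhSq coshSq coshSq α β γ))) := by
  have hgram : gram (1 + 2 * ((y + z) / x)) (1 + 2 * (z / x)) (1 + 2 * (y / x)) ≠ 0 :=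
    gram_add_ne_zero hx hy hz
  obtain ⟨hinj, hiff⟩ := gramSystem_cosh_iff (a := (y + z) / x) (b := z / x) (c := y / x)
    (by positivity) (by positivity) (by positivity) hgram
  rw [← hα, ← hβ, ← hγ] at hinj hiff
  have hρ : ∀ i, 0 < (![ρ₁, ρ₂, ρ₃] : Fin 3 → ℝ) i := by
    intro i
    fin_cases i
    · simp only [h₁, Fin.zero_eta, Matrix.cons_val]; positivity
    · simp only [h₂, Fin.mk_one, Matrix.cons_val]; positivity
    · simp only [h₃, Fin.reduceFinMk, Matrix.cons_val]; positivity
  rw [fourRows_signedRadii]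
  refine Solves.of_signedRows hinj hiff hgram (u := 1) (v := ![-1, 1, 1]) (ρ := ![ρ₁, ρ₂, ρ₃])
    one_ne_zero (by intro i; fin_cases i <;> simp) hρ ?_ ?_
  · rintro (n | n)
    · exact toGram_fourRows (f := Real.cosh) (v := ![-1, 1, 1]) hρ coshSq_eq sinhSq_eq sinhSq_eq
        α β γ n
    · exact toGram_fourRows (f := fun θ ↦ -Real.cosh θ) (v := ![-1, 1, 1]) hρ
        neg_sinhSq_eq neg_coshSq_eq neg_coshSq_eq α β γ n
  · intro R
    have e1 := pair_iff_gram_mixed hx hy hz hr h (R 0) (R 1)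
    have e2 := pair_iff_gram_mixed hx hz hy hr (by linear_combination h) (R 0) (R 2)
    have e3 := pair_iff_gram_add hy hz hx hr (by linear_combination h) (R 1) (R 2)
    rw [show x + z + y = x + y + z by ring] at e2
    rw [show y + z + x = x + y + z by ring] at e3
    simp only [System, GramSystem, toGram, Matrix.cons_val, one_mul, neg_one_mul, ct_self, ct_neg,
      ct_neg', h₁, h₂, h₃]
    rw [← e1, ← e2, ← e3]
    ring_nf
    tauto

/-- As `solves_A`, for the line `CA`. -/
theorem solves_B (hx : 0 < x) (hy : 0 < y) (hz : 0 < z) (hr : 0 < r)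
    (h : r ^ 2 * (x + y + z) = x * y * z) {α β γ : ℝ}
    (hα : α = sinhSqArg (z / y)) (hβ : β = sinhSqArg ((z + x) / y))
    (hγ : γ = sinhSqArg (x / y)) {ρ₁ ρ₂ ρ₃ : ℝ}
    (h₁ : ρ₁ = r * (x + y + z) / z) (h₂ : ρ₂ = r) (h₃ : ρ₃ = r * (x + y + z) / x) :
    Solves (System x y z r ![1, -1, 1])
      (signedRadii (Sum.elim (fourRows ρ₁ ρ₂ ρ₃ sinhSq coshSq sinhSq α β γ)
        (fourRows ρ₁ ρ₂ ρ₃ coshSq sinhSq coshSq α β γ))) := by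
  have hgram : gram (1 + 2 * (z / y)) (1 + 2 * ((z + x) / y)) (1 + 2 * (x / y)) ≠ 0 := by
    have := gram_add_ne_zero hy hz hx
    rwa [gram_cycle] at this
  obtain ⟨hinj, hiff⟩ := gramSystem_cosh_iff (a := z / y) (b := (z + x) / y) (c := x / y)
    (by positivity) (by positivity) (by positivity) hgram
  rw [← hα, ← hβ, ← hγ] at hinj hiff
  have hρ : ∀ i, 0 < (![ρ₁, ρ₂, ρ₃] : Fin 3 → ℝ) i := by
    intro i
    fin_cases i
    · simp only [h₁, Fin.zero_eta, Matrix.cons_val]; positivity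
    · simp only [h₂, Fin.mk_one, Matrix.cons_val]; positivity
    · simp only [h₃, Fin.reduceFinMk, Matrix.cons_val]; positivity
  rw [fourRows_signedRadii]
  refine Solves.of_signedRows hinj hiff hgram (u := 1) (v := ![1, -1, 1]) (ρ := ![ρ₁, ρ₂, ρ₃])
    one_ne_zero (by intro i; fin_cases i <;> simp) hρ ?_ ?_
  · rintro (n | n)
    · exact toGram_fourRows (f := Real.cosh) (v := ![1, -1, 1]) hρ sinhSq_eq coshSq_eq sinhSq_eq
        α β γ n
    · exact toGram_fourRows (f := fun θ ↦ -Real.cosh θ) (v := ![1, -1, 1]) hρ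
        neg_coshSq_eq neg_sinhSq_eq neg_coshSq_eq α β γ n
  · intro R
    have e1 := pair_iff_gram_mixed hy hx hz hr (by linear_combination h) (R 1) (R 0)
    have e2 := pair_iff_gram_add hz hx hy hr (by linear_combination h) (R 2) (R 0)
    have e3 := pair_iff_gram_mixed hy hz hx hr (by linear_combination h) (R 1) (R 2)
    rw [show y + x + z = x + y + z by ring, gram_swap] at e1
    rw [show z + x + y = x + y + z by ring, gram_swap] at e2
    rw [show y + z + x = x + y + z by ring] at e3
    simp only [System, GramSystem, toGram, Matrix.cons_val, one_mul, neg_one_mul, ct_self, ct_neg,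
      ct_neg', h₁, h₂, h₃]
    rw [← e1, ← e2, ← e3]
    ring_nf
    tauto

/-- As `solves_A`, for the line `AB`. -/
theorem solves_C (hx : 0 < x) (hy : 0 < y) (hz : 0 < z) (hr : 0 < r)
    (h : r ^ 2 * (x + y + z) = x * y * z) {α β γ : ℝ}
    (hα : α = sinhSqArg (y / z)) (hβ : β = sinhSqArg (x / z))
    (hγ : γ = sinhSqArg ((x + y) / z)) {ρ₁ ρ₂ ρ₃ : ℝ}
    (h₁ : ρ₁ = r * (x + y + z) / y) (h₂ : ρ₂ = r * (x + y + z) / x) (h₃ : ρ₃ = r) :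
    Solves (System x y z r ![1, 1, -1])
      (signedRadii (Sum.elim (fourRows ρ₁ ρ₂ ρ₃ sinhSq sinhSq coshSq α β γ)
        (fourRows ρ₁ ρ₂ ρ₃ coshSq coshSq sinhSq α β γ))) := by
  have hgram : gram (1 + 2 * (y / z)) (1 + 2 * (x / z)) (1 + 2 * ((x + y) / z)) ≠ 0 := by
    have := gram_add_ne_zero hz hx hy
    rwa [gram_cycle, gram_cycle] at this
  obtain ⟨hinj, hiff⟩ := gramSystem_cosh_iff (a := y / z) (b := x / z) (c := (x + y) / z)
    (by positivity) (by positivity) (by positivity) hgram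
  rw [← hα, ← hβ, ← hγ] at hinj hiff
  have hρ : ∀ i, 0 < (![ρ₁, ρ₂, ρ₃] : Fin 3 → ℝ) i := by
    intro i
    fin_cases i
    · simp only [h₁, Fin.zero_eta, Matrix.cons_val]; positivity
    · simp only [h₂, Fin.mk_one, Matrix.cons_val]; positivity
    · simp only [h₃, Fin.reduceFinMk, Matrix.cons_val]; positivity
  rw [fourRows_signedRadii]
  refine Solves.of_signedRows hinj hiff hgram (u := 1) (v := ![1, 1, -1]) (ρ := ![ρ₁, ρ₂, ρ₃])
    one_ne_zero (by intro i; fin_cases i <;> simp) hρ ?_ ?_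
  · rintro (n | n)
    · exact toGram_fourRows (f := Real.cosh) (v := ![1, 1, -1]) hρ sinhSq_eq sinhSq_eq coshSq_eq
        α β γ n
    · exact toGram_fourRows (f := fun θ ↦ -Real.cosh θ) (v := ![1, 1, -1]) hρ
        neg_coshSq_eq neg_coshSq_eq neg_sinhSq_eq α β γ n
  · intro R
    have e1 := pair_iff_gram_add hx hy hz hr h (R 0) (R 1)
    have e2 := pair_iff_gram_mixed hz hx hy hr (by linear_combination h) (R 2) (R 0)
    have e3 := pair_iff_gram_mixed hz hy hx hr (by linear_combination h) (R 2) (R 1)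
    rw [show z + x + y = x + y + z by ring, gram_swap] at e2
    rw [show z + y + x = x + y + z by ring, gram_swap] at e3
    simp only [System, GramSystem, toGram, Matrix.cons_val, one_mul, neg_one_mul, ct_self, ct_neg,
      ct_neg', h₁, h₂, h₃]
    rw [← e1, ← e2, ← e3]
    ring_nf
    tauto

end

/-! ### The triangle and the seven cases -/

section

variable {κ x y z r : ℝ} {T : Affine.Triangle ℝ Plane}

theorem exists_oriented (T : Affine.Triangle ℝ Plane) :
    ∃ κ, Oriented κ (T.points 0) (T.points 1) (T.points 2) := by
  have hne : T.points 0 ≠ T.points 1 := fun h ↦ by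
    simpa using T.independent.injective h
  have hcr : cr (T.points 1 - T.points 0) (T.points 2 - T.points 0) ≠ 0 := by
    intro h
    have h2 : T.points 2 ∈ line[ℝ, T.points 0, T.points 1] := by
      rw [mem_line_iff (κ := 1) (by norm_num) hne, sgd, h]
      simp
    refine affineIndependent_iff_not_collinear.1 T.independent
      ((collinear_insert_of_mem_affineSpan_pair h2).subset ?_)
    rintro _ ⟨i, rfl⟩
    fin_cases i <;> simp
  rcases lt_or_gt_of_ne hcr with h | h
  · exact ⟨-1, by norm_num, by linarith⟩
  · exact ⟨1, by norm_num, by linarith⟩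

/-- The height is twice the area divided by the base. -/
theorem height_eq {i j k : Fin 3} (hij : i ≠ j) (hik : i ≠ k) (hjk : j ≠ k)
    (h : Oriented κ (T.points i) (T.points j) (T.points k)) :
    T.height i = κ * cr (T.points j - T.points i) (T.points k - T.points i) /
      dist (T.points j) (T.points k) := by
  have hκ := h.sq_eq_one
  have hd : 0 < dist (T.points j) (T.points k) := dist_pos.2 h.rotate.ne
  have h1 := T.inner_vsub_vsub_altitudeFoot_eq_height_sq hij
  have h2 := T.inner_vsub_vsub_altitudeFoot_eq_height_sq hik
  have hmem : T.altitudeFoot i ∈ line[ℝ, T.points j, T.points k] := by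
    have := T.altitudeFoot_mem_affineSpan_image_compl i
    refine affineSpan_mono ℝ ?_ this
    rintro _ ⟨l, hl, rfl⟩
    have hl' : l ≠ i := hl
    obtain rfl | rfl : l = j ∨ l = k := by omega
    · simp
    · simp
  have hpos : pos (T.points j) (T.points k) (T.points i) =
      pos (T.points j) (T.points k) (T.altitudeFoot i) := by
    rw [← sub_eq_zero, pos_sub_pos, div_eq_zero_iff]
    left
    rw [vsub_eq_sub, vsub_eq_sub, inner_eq_dt] at h1 h2
    simp only [dt, PiLp.sub_apply] at h1 h2 ⊢
    linear_combination h1 - h2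
  have h3 := dist_sq_eq_pos_sgd hκ h.rotate.ne (T.points i) (T.altitudeFoot i)
  rw [hpos, sub_self, (mem_line_iff hκ h.rotate.ne).1 hmem] at h3
  have h4 : sgd κ (T.points j) (T.points k) (T.points i) =
      κ * cr (T.points j - T.points i) (T.points k - T.points i) /
        dist (T.points j) (T.points k) := by
    rw [sgd, cr_rotate]
  rw [h4] at h3
  have h5 : 0 < κ * cr (T.points j - T.points i) (T.points k - T.points i) /
      dist (T.points j) (T.points k) := div_pos h.det_pos hd
  exact (sq_eq_sq₀ dist_nonneg h5.le).1 (by rw [h3]; ring)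

/-- The inradius and the exradii in terms of the tangent lengths. The reciprocals of these radii
are the sums of the reciprocals of the heights, with a minus sign for one of them in the case of
an exradius. -/
theorem Sizes.radii (h : Sizes κ (T.points 0) (T.points 1) (T.points 2) x y z r) :
    T.inradius = r ∧ exrad T 0 = r * (x + y + z) / x ∧ exrad T 1 = r * (x + y + z) / y ∧
      exrad T 2 = r * (x + y + z) / z := by
  have hx := h.x_pos
  have hy := h.y_pos
  have hz := h.z_pos
  have hr := h.r_pos
  have w0 : (T.height 0)⁻¹ = (y + z) / (2 * r * (x + y + z)) := by
    rw [height_eq (by decide) (by decide) (by decide) h.oriented, h.det_eq, h.dist_BC, inv_div]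
  have w1 : (T.height 1)⁻¹ = (z + x) / (2 * r * (x + y + z)) := by
    rw [height_eq (by decide) (by decide) (by decide) h.rotate.oriented, h.rotate.det_eq,
      h.rotate.dist_BC, inv_div]
    congr 1; ring
  have w2 : (T.height 2)⁻¹ = (x + y) / (2 * r * (x + y + z)) := by
    rw [height_eq (by decide) (by decide) (by decide) h.rotate.rotate.oriented,
      h.rotate.rotate.det_eq, h.rotate.rotate.dist_BC, inv_div]
    congr 1; ring
  have hsum : ∀ S, ∑ i, T.excenterWeightsUnnorm S i = T.excenterWeightsUnnorm S 0 +
      T.excenterWeightsUnnorm S 1 + T.excenterWeightsUnnorm S 2 := fun S ↦ Fin.sum_univ_three _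
  have hrad : ∀ S t, 0 < t → T.excenterWeightsUnnorm S 0 +
      T.excenterWeightsUnnorm S 1 + T.excenterWeightsUnnorm S 2 = t⁻¹ →
      |(∑ i, T.excenterWeightsUnnorm S i)⁻¹| = t := fun S t ht h ↦ by
    rw [hsum, h, inv_inv, abs_of_pos ht]
  refine ⟨?_, ?_, ?_, ?_⟩
  · rw [T.inradius_eq_abs_inv_sum]
    refine hrad _ _ hr ?_
    simp only [Affine.Simplex.excenterWeightsUnnorm, w0, w1, w2]
    simp
    field_simp
    ring
  · rw [exrad, T.exradius_eq_abs_inv_sum]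
    refine hrad _ _ (by positivity) ?_
    simp only [Affine.Simplex.excenterWeightsUnnorm, w0, w1, w2]
    simp
    field_simp
    ring
  · rw [exrad, T.exradius_eq_abs_inv_sum]
    refine hrad _ _ (by positivity) ?_
    simp only [Affine.Simplex.excenterWeightsUnnorm, w0, w1, w2]
    simp
    field_simp
    ring
  · rw [exrad, T.exradius_eq_abs_inv_sum]
    refine hrad _ _ (by positivity) ?_
    simp only [Affine.Simplex.excenterWeightsUnnorm, w0, w1, w2]
    simp
    field_simp
    ring

/-- For each case, the sides of the lines `BC`, `CA`, `AB` on which the circles touching these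
lines lie: `1` is the side of the triangle. -/
def caseSigns : Case → Fin 3 → ℝ
  | .case1 => ![1, 1, 1]
  | .case2 => ![-1, 1, 1]
  | .case3 => ![1, -1, -1]
  | .case4 => ![1, -1, 1]
  | .case5 => ![-1, 1, -1]
  | .case6 => ![1, 1, -1]
  | .case7 => ![-1, -1, 1]

theorem caseSigns_eq_or (k : Case) (i : Fin 3) : caseSigns k i = 1 ∨ caseSigns k i = -1 := by
  cases k <;> fin_cases i <;> simp [caseSigns]

theorem caseSigns_injective : Function.Injective caseSigns := by
  intro k l h
  have h0 := congrFun h 0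
  have h1 := congrFun h 1
  have h2 := congrFun h 2
  have hp : (1 : ℝ) ≠ -1 := by norm_num
  have hn : (-1 : ℝ) ≠ 1 := hp.symm
  cases k <;> cases l <;> first
    | rfl
    | exact absurd h0 hp
    | exact absurd h0 hn
    | exact absurd h1 hp
    | exact absurd h1 hn
    | exact absurd h2 hp
    | exact absurd h2 hn

/-- The seven cases are all the patterns of signs but `(-1, -1, -1)`. -/
theorem exists_caseSigns_eq {e : Fin 3 → ℝ} (he : ∀ i, e i = 1 ∨ e i = -1) :
    (∃ k, e = caseSigns k) ∨ e = -![1, 1, 1] := by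
  have hE : e = ![e 0, e 1, e 2] := by
    funext i; fin_cases i <;> rfl
  rw [hE]
  rcases he 0 with h0 | h0 <;> rcases he 1 with h1 | h1 <;> rcases he 2 with h2 | h2 <;>
    rw [h0, h1, h2]
  · exact Or.inl ⟨.case1, rfl⟩
  · exact Or.inl ⟨.case6, rfl⟩
  · exact Or.inl ⟨.case4, rfl⟩
  · exact Or.inl ⟨.case3, rfl⟩
  · exact Or.inl ⟨.case2, rfl⟩
  · exact Or.inl ⟨.case5, rfl⟩
  · exact Or.inl ⟨.case7, rfl⟩
  · right
    funext i; fin_cases i <;> simp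

theorem inCase_iff_angleInterior (ω : Fin 3 → Sphere Plane) (k : Case) :
    InCase T ω k ↔
      (ω 0).center ∈ angleInterior T 2 0 1 (caseSigns k 2) (caseSigns k 1) ∧
      (ω 1).center ∈ angleInterior T 0 1 2 (caseSigns k 0) (caseSigns k 2) ∧
      (ω 2).center ∈ angleInterior T 1 2 0 (caseSigns k 1) (caseSigns k 0) := by
  cases k <;> rfl

theorem inCase_tripleOf_iff (h : Oriented κ (T.points 0) (T.points 1) (T.points 2))
    {e R : Fin 3 → ℝ} (he : ∀ i, e i = 1 ∨ e i = -1) (hR : ∀ i, 0 < R i) (k : Case) :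
    InCase T (tripleOf κ (T.points 0) (T.points 1) (T.points 2) e R) k ↔ e = caseSigns k := by
  have hκ := h.sq_eq_one
  have hAB := h.ne
  have hBC := h.rotate.ne
  have hCA := h.rotate.rotate.ne
  have hsq : ∀ i, caseSigns k i ^ 2 = 1 := fun i ↦ by
    rcases caseSigns_eq_or k i with h | h <;> rw [h] <;> norm_num
  obtain ⟨h1, h2, h3, h4, h5, h6⟩ := h.sgd_tripleOf e R
  have key : ∀ i j, 0 < caseSigns k i * (e i * R j) ↔ e i = caseSigns k i := by
    intro i j
    have := hR j
    rcases he i with h | h <;> rcases caseSigns_eq_or k i with h' | h' <;> rw [h, h'] <;>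
      constructor <;> intro _ <;> linarith
  rw [inCase_iff_angleInterior]
  simp only [angleInterior, Set.mem_ofPred_eq]
  rw [exists_smul_iff_sgd hAB hCA h.det_pos hκ (hsq _) (hsq _),
    exists_smul_iff_sgd hBC hAB h.rotate.det_pos hκ (hsq _) (hsq _),
    exists_smul_iff_sgd hCA hBC h.rotate.rotate.det_pos hκ (hsq _) (hsq _), h1, h2, h3, h4, h5, h6,
    key, key, key, key, key, key]
  constructor
  · rintro ⟨⟨a, b⟩, ⟨c, -⟩, -⟩
    funext i
    fin_cases i
    · exact c
    · exact b
    · exact a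
  · rintro rfl
    simp

theorem Sizes.triplesIn_eq (h : Sizes κ (T.points 0) (T.points 1) (T.points 2) x y z r)
    (k : Case) : triplesIn T k = tripleOf κ (T.points 0) (T.points 1) (T.points 2) (caseSigns k) ''
      {R | (∀ i, 0 < R i) ∧ System x y z r (caseSigns k) R} := by
  ext ω
  constructor
  · rintro ⟨h1, h2⟩
    have hc := (isMalfattiTriple_iff h.oriented ω).1 h1
    obtain ⟨e, R, he, hR, rfl⟩ := hc.exists_eq_tripleOf h.oriented
    rw [inCase_tripleOf_iff h.oriented he hR] at h2
    subst h2
    exact ⟨R, ⟨hR, (h.config_tripleOf_iff he hR).1 hc⟩, rfl⟩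
  · rintro ⟨R, ⟨hR, hS⟩, rfl⟩
    exact ⟨(isMalfattiTriple_iff h.oriented _).2
      ((h.config_tripleOf_iff (caseSigns_eq_or k) hR).2 hS),
      (inCase_tripleOf_iff h.oriented (caseSigns_eq_or k) hR k).2 rfl⟩

/-- Two opposite cases together are the solutions of one system. -/
theorem Sizes.triplesIn_union (h : Sizes κ (T.points 0) (T.points 1) (T.points 2) x y z r)
    {k l : Case} (hkl : caseSigns l = -caseSigns k)
    (hsign : ∀ R, System x y z r (caseSigns k) R → (∀ i, 0 < R i) ∨ ∀ i, R i < 0) :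
    triplesIn T k ∪ triplesIn T l =
      tripleOf κ (T.points 0) (T.points 1) (T.points 2) (caseSigns k) ''
        {R | System x y z r (caseSigns k) R} := by
  rw [h.triplesIn_eq, h.triplesIn_eq, hkl]
  ext ω
  constructor
  · rintro (⟨R, ⟨-, hR⟩, rfl⟩ | ⟨R, ⟨-, hR⟩, rfl⟩)
    · exact ⟨R, hR, rfl⟩
    · refine ⟨-R, ?_, ?_⟩
      · rw [Set.mem_ofPred_eq, ← system_neg, neg_neg]
        exact hR
      · rw [← tripleOf_neg, neg_neg]
  · rintro ⟨R, hR, rfl⟩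
    rcases hsign R hR with hp | hn
    · exact Or.inl ⟨R, ⟨hp, hR⟩, rfl⟩
    · refine Or.inr ⟨-R, ⟨fun i ↦ neg_pos.2 (hn i), system_neg.2 hR⟩, tripleOf_neg _ _ _ _ _ _⟩

theorem Solves.radiiGivenBy (h : Oriented κ (T.points 0) (T.points 1) (T.points 2))
    {e : Fin 3 → ℝ} (he : ∀ i, e i = 1 ∨ e i = -1) {P : (Fin 3 → ℝ) → Prop}
    {rows radii : Fin 4 ⊕ Fin 4 → Fin 3 → ℝ} (hs : Solves P rows)
    (habs : ∀ n i, |rows n i| = radii n i) {S : Set (Fin 3 → Sphere Plane)}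
    (hS : S = tripleOf κ (T.points 0) (T.points 1) (T.points 2) e '' {R | P R}) :
    RadiiGivenBy S radii := by
  subst hS
  have hinj := h.tripleOf_injective (e := e) fun i ↦ by
    rcases he i with h | h <;> rw [h] <;> norm_num
  refine ⟨Equiv.ofBijective
    (fun n ↦ ⟨tripleOf κ (T.points 0) (T.points 1) (T.points 2) e (rows n),
      Set.mem_image_of_mem _ ((hs.iff _).2 ⟨n, rfl⟩)⟩) ⟨?_, ?_⟩, ?_⟩
  · intro n m hnm
    exact hs.injective (hinj (congrArg Subtype.val hnm))
  · rintro ⟨_, R, hR, rfl⟩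
    obtain ⟨n, rfl⟩ := (hs.iff R).1 hR
    exact ⟨n, rfl⟩
  · intro n i
    rw [← habs]
    fin_cases i <;> rfl

theorem RadiiGivenBy.ncard_eq {S : Set (Fin 3 → Sphere Plane)}
    {radii : Fin 4 ⊕ Fin 4 → Fin 3 → ℝ} (h : RadiiGivenBy S radii) : S.ncard = 8 := by
  obtain ⟨e, -⟩ := h
  rw [← Nat.card_coe_set_eq, ← Nat.card_congr e]
  simp

/-- Non-negative radii are positive because entries of solutions do not vanish. -/
theorem Solves.sign {P : (Fin 3 → ℝ) → Prop} {radii : Fin 4 ⊕ Fin 4 → Fin 3 → ℝ}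
    (hs : Solves P (signedRadii radii)) (hnonneg : ∀ n i, 0 ≤ radii n i) (R : Fin 3 → ℝ)
    (hR : P R) : (∀ i, 0 < R i) ∨ ∀ i, R i < 0 := by
  obtain ⟨n, rfl⟩ := (hs.iff R).1 hR
  rcases n with n | n
  · exact Or.inl fun i ↦ lt_of_le_of_ne (hnonneg _ i) (hs.ne_zero (.inl n) i).symm
  · exact Or.inr fun i ↦ lt_of_le_of_ne (neg_nonpos.2 (hnonneg _ i)) (hs.ne_zero (.inr n) i)

theorem abs_signedRadii {radii : Fin 4 ⊕ Fin 4 → Fin 3 → ℝ} (hnonneg : ∀ n i, 0 ≤ radii n i)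
    (n : Fin 4 ⊕ Fin 4) (i : Fin 3) : |signedRadii radii n i| = radii n i := by
  rcases n with n | n
  · exact abs_of_nonneg (hnonneg _ i)
  · exact (abs_neg _).trans (abs_of_nonneg (hnonneg _ i))

theorem disjoint_triplesIn (T : Affine.Triangle ℝ Plane) {k l : Case} (hkl : k ≠ l) :
    Disjoint (triplesIn T k) (triplesIn T l) := by
  obtain ⟨κ, h⟩ := exists_oriented T
  refine Set.disjoint_left.2 ?_
  rintro ω ⟨h1, h2⟩ ⟨-, h3⟩
  obtain ⟨e, R, he, hR, rfl⟩ := ((isMalfattiTriple_iff h ω).1 h1).exists_eq_tripleOf h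
  rw [inCase_tripleOf_iff h he hR] at h2 h3
  exact hkl (caseSigns_injective (h2.symm.trans h3))

theorem sumElim_fourRows_nonneg {ρ₁ ρ₂ ρ₃ α β γ : ℝ} (h₁ : 0 < ρ₁) (h₂ : 0 < ρ₂) (h₃ : 0 < ρ₃)
    {f₁ f₂ f₃ g₁ g₂ g₃ : ℝ → ℝ} (hf₁ : ∀ θ, 0 ≤ f₁ θ) (hf₂ : ∀ θ, 0 ≤ f₂ θ) (hf₃ : ∀ θ, 0 ≤ f₃ θ)
    (hg₁ : ∀ θ, 0 ≤ g₁ θ) (hg₂ : ∀ θ, 0 ≤ g₂ θ) (hg₃ : ∀ θ, 0 ≤ g₃ θ) (n : Fin 4 ⊕ Fin 4)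
    (i : Fin 3) : 0 ≤ Sum.elim (fourRows ρ₁ ρ₂ ρ₃ f₁ f₂ f₃ α β γ)
      (fourRows ρ₁ ρ₂ ρ₃ g₁ g₂ g₃ α β γ) n i := by
  have hρ : ∀ i, 0 < (![ρ₁, ρ₂, ρ₃] : Fin 3 → ℝ) i := by
    intro i; fin_cases i <;> assumption
  rcases n with n | n
  · exact fourRows_nonneg hρ hf₁ hf₂ hf₃ α β γ n i
  · exact fourRows_nonneg hρ hg₁ hg₂ hg₃ α β γ n i

theorem sinSq_nonneg (θ : ℝ) : 0 ≤ sinSq θ := sq_nonneg _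
theorem cosSq_nonneg (θ : ℝ) : 0 ≤ cosSq θ := sq_nonneg _
theorem sinhSq_nonneg (θ : ℝ) : 0 ≤ sinhSq θ := sq_nonneg _
theorem coshSq_nonneg (θ : ℝ) : 0 ≤ coshSq θ := sq_nonneg _

end

end Malfatti

open Malfatti in
theorem mainTheorem1 (T : Affine.Triangle ℝ Malfatti.Plane) :
    (Malfatti.triples T).ncard = 32 ∧
    Malfatti.triples T =
      Malfatti.triplesIn T .case1 ∪
      (Malfatti.triplesIn T .case2 ∪ Malfatti.triplesIn T .case3) ∪
      (Malfatti.triplesIn T .case4 ∪ Malfatti.triplesIn T .case5) ∪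
      (Malfatti.triplesIn T .case6 ∪ Malfatti.triplesIn T .case7) ∧
    (Malfatti.triplesIn T .case1).ncard = 8 ∧
    (Malfatti.triplesIn T .case2 ∪ Malfatti.triplesIn T .case3).ncard = 8 ∧
    (Malfatti.triplesIn T .case4 ∪ Malfatti.triplesIn T .case5).ncard = 8 ∧
    (Malfatti.triplesIn T .case6 ∪ Malfatti.triplesIn T .case7).ncard = 8 ∧
    Malfatti.RadiiGivenBy (Malfatti.triplesIn T .case1) (Malfatti.radiiI T) ∧
    Malfatti.RadiiGivenBy (Malfatti.triplesIn T .case2 ∪ Malfatti.triplesIn T .case3)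
      (Malfatti.radiiA T) ∧
    Malfatti.RadiiGivenBy (Malfatti.triplesIn T .case4 ∪ Malfatti.triplesIn T .case5)
      (Malfatti.radiiB T) ∧
    Malfatti.RadiiGivenBy (Malfatti.triplesIn T .case6 ∪ Malfatti.triplesIn T .case7)
      (Malfatti.radiiC T) := by
  obtain ⟨κ, hT⟩ := exists_oriented T
  have hsz := hT.sizes (s := semi T) (x := semi T - sideA T) (y := semi T - sideB T)
    (z := semi T - sideC T) rfl rfl rfl rfl
  obtain ⟨r, hr⟩ : ∃ r, r = κ * cr (T.points 1 - T.points 0) (T.points 2 - T.points 0) /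
    (2 * semi T) := ⟨_, rfl⟩
  rw [← hr] at hsz
  obtain ⟨x, hx⟩ : ∃ x, x = semi T - sideA T := ⟨_, rfl⟩
  obtain ⟨y, hy⟩ : ∃ y, y = semi T - sideB T := ⟨_, rfl⟩
  obtain ⟨z, hz⟩ : ∃ z, z = semi T - sideC T := ⟨_, rfl⟩
  have ha : sideA T = y + z := by rw [hy, hz, semi]; ring
  have hb : sideB T = z + x := by rw [hx, hz, semi]; ring
  have hc : sideC T = x + y := by rw [hx, hy, semi]; ring
  have hs : semi T = x + y + z := by rw [hx, hy, hz, semi]; ring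
  rw [← hx, ← hy, ← hz] at hsz
  have x_pos := hsz.x_pos
  have y_pos := hsz.y_pos
  have z_pos := hsz.z_pos
  have r_pos := hsz.r_pos
  obtain ⟨hin, hA, hB, hC⟩ := hsz.radii
  have pA : 0 < exrad T 0 := by rw [hA]; positivity
  have pB : 0 < exrad T 1 := by rw [hB]; positivity
  have pC : 0 < exrad T 2 := by rw [hC]; positivity
  have pin : 0 < T.inradius := by rw [hin]; exact r_pos
  have sI : Solves (System x y z r (caseSigns .case1)) (radiiI T) :=
    solves_one x_pos y_pos z_pos r_pos hsz.r_sq (by rw [ha, hs]) (by rw [hb, hs])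
      (by rw [hc, hs]) hA hB hC
  have sA : Solves (System x y z r (caseSigns .case2)) (signedRadii (radiiA T)) :=
    solves_A x_pos y_pos z_pos r_pos hsz.r_sq (by rw [← hx, ha]) (by rw [← hx, ← hz])
      (by rw [← hx, ← hy]) hin hC hB
  have sB : Solves (System x y z r (caseSigns .case4)) (signedRadii (radiiB T)) :=
    solves_B x_pos y_pos z_pos r_pos hsz.r_sq (by rw [← hy, ← hz]) (by rw [← hy, hb])
      (by rw [← hy, ← hx]) hC hin hA
  have sC : Solves (System x y z r (caseSigns .case6)) (signedRadii (radiiC T)) :=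
    solves_C x_pos y_pos z_pos r_pos hsz.r_sq (by rw [← hz, ← hy]) (by rw [← hz, ← hx])
      (by rw [← hz, hc]) hB hA hin
  have nI : ∀ n i, 0 ≤ radiiI T n i := sumElim_fourRows_nonneg pA pB pC
    sinSq_nonneg sinSq_nonneg sinSq_nonneg cosSq_nonneg cosSq_nonneg cosSq_nonneg
  have nA : ∀ n i, 0 ≤ radiiA T n i := sumElim_fourRows_nonneg pin pC pB
    coshSq_nonneg sinhSq_nonneg sinhSq_nonneg sinhSq_nonneg coshSq_nonneg coshSq_nonneg
  have nB : ∀ n i, 0 ≤ radiiB T n i := sumElim_fourRows_nonneg pC pin pA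
    sinhSq_nonneg coshSq_nonneg sinhSq_nonneg coshSq_nonneg sinhSq_nonneg coshSq_nonneg
  have nC : ∀ n i, 0 ≤ radiiC T n i := sumElim_fourRows_nonneg pB pA pin
    sinhSq_nonneg sinhSq_nonneg coshSq_nonneg coshSq_nonneg coshSq_nonneg sinhSq_nonneg
  -- the solutions for the inner sides are all positive, so that none belongs to the outer sides
  have posI : ∀ R, System x y z r (caseSigns .case1) R → ∀ i, 0 < R i := by
    intro R hR i
    obtain ⟨n, rfl⟩ := (sI.iff R).1 hR
    exact lt_of_le_of_ne (nI n i) (sI.ne_zero n i).symm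
  have eI : triplesIn T .case1 =
      tripleOf κ (T.points 0) (T.points 1) (T.points 2) (caseSigns .case1) ''
        {R | System x y z r (caseSigns .case1) R} := by
    rw [hsz.triplesIn_eq]
    congr 1
    ext R
    exact ⟨fun h ↦ h.2, fun h ↦ ⟨posI R h, h⟩⟩
  have eA := hsz.triplesIn_union (k := .case2) (l := .case3) (by simp [caseSigns]) (sA.sign nA)
  have eB := hsz.triplesIn_union (k := .case4) (l := .case5) (by simp [caseSigns]) (sB.sign nB)
  have eC := hsz.triplesIn_union (k := .case6) (l := .case7) (by simp [caseSigns]) (sC.sign nC)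
  have gI : RadiiGivenBy (triplesIn T .case1) (radiiI T) :=
    sI.radiiGivenBy hT (caseSigns_eq_or _) (fun n i ↦ abs_of_nonneg (nI n i)) eI
  have gA : RadiiGivenBy (triplesIn T .case2 ∪ triplesIn T .case3) (radiiA T) :=
    sA.radiiGivenBy hT (caseSigns_eq_or _) (abs_signedRadii nA) eA
  have gB : RadiiGivenBy (triplesIn T .case4 ∪ triplesIn T .case5) (radiiB T) :=
    sB.radiiGivenBy hT (caseSigns_eq_or _) (abs_signedRadii nB) eB
  have gC : RadiiGivenBy (triplesIn T .case6 ∪ triplesIn T .case7) (radiiC T) :=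
    sC.radiiGivenBy hT (caseSigns_eq_or _) (abs_signedRadii nC) eC
  have hunion : triples T = triplesIn T .case1 ∪ (triplesIn T .case2 ∪ triplesIn T .case3) ∪
      (triplesIn T .case4 ∪ triplesIn T .case5) ∪ (triplesIn T .case6 ∪ triplesIn T .case7) := by
    refine Set.Subset.antisymm (fun ω hω ↦ ?_) ?_
    · have hω' : IsMalfattiTriple T ω := hω
      have hconf := (isMalfattiTriple_iff hT ω).1 hω'
      obtain ⟨e, R, he, hR, rfl⟩ := hconf.exists_eq_tripleOf hT
      rcases exists_caseSigns_eq he with ⟨k, rfl⟩ | rfl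
      · have hk : tripleOf κ (T.points 0) (T.points 1) (T.points 2) (caseSigns k) R ∈
            triplesIn T k := ⟨hω', (inCase_tripleOf_iff hT he hR k).2 rfl⟩
        cases k <;> simp only [Set.mem_union] <;> tauto
      · -- circles on the outer sides of all three lines would have negative radii
        have h1 := (hsz.config_tripleOf_iff he hR).1 hconf
        rw [← neg_neg R, system_neg] at h1
        have h2 := posI _ h1 0
        have h3 := hR 0
        rw [Pi.neg_apply] at h2
        linarith
    · rintro ω (((h | h | h) | h | h) | h | h) <;> exact h.1
  have d : ∀ {k l}, k ≠ l → Disjoint (triplesIn T k) (triplesIn T l) := disjoint_triplesIn T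
  have fin : ∀ {S : Set (Fin 3 → Sphere Plane)}, S.ncard = 8 → S.Finite := fun h ↦
    Set.finite_of_ncard_ne_zero (by rw [h]; norm_num)
  refine ⟨?_, hunion, gI.ncard_eq, gA.ncard_eq, gB.ncard_eq, gC.ncard_eq, gI, gA, gB, gC⟩
  have fI := fin gI.ncard_eq
  have fA := fin gA.ncard_eq
  have fB := fin gB.ncard_eq
  have fC := fin gC.ncard_eq
  rw [hunion, Set.ncard_union_eq ?_ ((fI.union fA).union fB) fC,
    Set.ncard_union_eq ?_ (fI.union fA) fB, Set.ncard_union_eq ?_ fI fA, gI.ncard_eq, gA.ncard_eq,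
    gB.ncard_eq, gC.ncard_eq]
  all_goals
    simp only [Set.disjoint_union_left, Set.disjoint_union_right]
    simp [d]
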